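/- A structure is a set with relations indexed by a fixed signature (all arities $\ge 1$); an embedding is an injection inducing an isomorphism onto its image with the induced relations. A Fraïssé class $\mathfrak F$ is a non-empty hereditary class of finite structures with the amalgamation property, with finitely many $n$-element members up to isomorphism for each $n$. An amalgamation of $X$ and $Y$ (in $\mathfrak F$) is a member $Z$ of $\mathfrak F$ with jointly surjective embeddings $X\to Z$, $Y\to Z$; it is an amalgamation over $W$ if these agree on $W$, for given embeddings $W\to X$, $W\to Y$; $\mathrm{Amalg}(X,Y)$ is the set of isomorphism classes of amalgamations. A measure for $\mathfrak F$ with values in a commutative ring $k$ assigns to each embedding $i$ in $\mathfrak F$ an element $\mu(i)\in k$ such that $\mu(i)=1$ for isomorphisms, $\mu(j\circ i)=\mu(j)\mu(i)$, and $\mu(X\to Y)=\sum_\alpha \mu(X'\to Y'_\alpha)$ for embeddings $X\to Y$, $X\to X'$, where $Y'_\alpha$ runs over the amalgamations of $X'$ and $Y$ over $X$. Put $\mu(X)=\mu(\emptyset\to X)$. The $k$-linear symmetric monoidal category $\underline{\mathrm{Perm}}_k(\mathfrak F;\mu)$ is the additive envelope of the category with objects $\mathrm{Vec}_X$ ($X\in\mathfrak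 F$) and $\mathrm{Hom}(\mathrm{Vec}_X,\mathrm{Vec}_Y)=k[\mathrm{Amalg}(X,Y)]$, with basis elements denoted $\phi_Z$ and composition $\phi_{Y_2}\circ\phi_{Y_1}=\sum_Z\mu(Y_3\to Z)\,\phi_{Y_3}$, where $Z$ runs over the amalgamations of $X_1,X_2,X_3$ in which the joint images of $X_1,X_2$ and of $X_2,X_3$ are $Y_1$ and $Y_2$, and $Y_3$ is the joint image of $X_1,X_3$. The tensor product satisfies $\mathrm{Vec}_X\otimes\mathrm{Vec}_Y=\bigoplus_{Z\in\mathrm{Amalg}(X,Y)}\mathrm{Vec}_Z$ with unit $\mathrm{Vec}_\emptyset$. On morphisms it is the Kronecker product, when a morphism $\sum_Z c_Z\phi_Z\colon \mathrm{Vec}_X\to\mathrm{Vec}_Y$ is viewed as the matrix whose entry at a pair of embeddings $X\to W$, $Y\to W$ ($W \in \mathfrak F$) is $c_Z$, for $Z$ the joint image, and pairs of embeddings $X\to W$, $Y\to W$ are identified with the embeddings into $W$ of the $Z\in\mathrm{Amalg}(X,Y)$; the associativity, unit and symmetry isomorphisms are the permutation matrices of the evident bijections. **Proposition.** Let $\mathfrak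 F$ be a Fraïssé class, $\mu$ a measure for $\mathfrak F$ with values in an integral domain $k$, $\mathfrak F'\subseteq\mathfrak F$ the subclass of structures $X$ with $\mu(X)\neq 0$ (which is again a Fraïssé class), and $\mu'$ the restriction of $\mu$ to $\mathfrak F'$ (which is again a measure). There is a tensor functor, that is, a $k$-linear (strong) symmetric monoidal functor, $$\Phi\colon \underline{\mathrm{Perm}}_k(\mathfrak F;\mu)\to\underline{\mathrm{Perm}}_k(\mathfrak F';\mu')$$ satisfying $$\Phi(\mathrm{Vec}_X)=\begin{cases}\mathrm{Vec}_X & X\in\mathfrak F'\\ 0&\text{otherwise,}\end{cases}\qquad \Phi(\phi_Z)=\begin{cases}\phi_Z & Z\in\mathfrak F'\\ 0&\text{otherwise,}\end{cases}$$ where the equalities of objects are isomorphisms, chosen once for each object and carrying $\Phi(\phi_Z)$ to $\phi_Z$. The functor $\Phi$ is essentially surjective and full. -/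

import Mathlib

open CategoryTheory FirstOrder

universe u v w r

noncomputable section

namespace Fraisse

/-- A Fraïssé class of finite structures for the signature `L` (a relational first-order language;
that there are only relations, of arity at least one, is imposed through the instances
`L.IsRelational` and `IsEmpty (L.Relations 0)` wherever it matters): a non-empty hereditary class of
finite structures with the amalgamation property, having only finitely many `n`-element members
up to isomorphism for each `n`. -/
structure FraisseClass (L : FirstOrder.Language.{u, v}) where
  carrier : Set (Bundled.{w} L.Structure)
  nonempty : carrier.Nonempty
  finite : ∀ X ∈ carrier, Finite X
  finitely_many : ∀ n : ℕ, ∃ S : Set (Bundled.{w} L.Structure), S.Finite ∧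
    ∀ X ∈ carrier, Nat.card X = n → ∃ Y ∈ S, Nonempty (X ≃[L] Y)
  hereditary : ∀ X ∈ carrier, ∀ Y : Bundled.{w} L.Structure, Nonempty (Y ↪[L] X) → Y ∈ carrier
  amalgamation : ∀ X ∈ carrier, ∀ Y₁ ∈ carrier, ∀ Y₂ ∈ carrier,
    ∀ (i₁ : X ↪[L] Y₁) (i₂ : X ↪[L] Y₂), ∃ Z ∈ carrier, ∃ (j₁ : Y₁ ↪[L] Z) (j₂ : Y₂ ↪[L] Z),
      j₁.comp i₁ = j₂.comp i₂ ∧ Set.range j₁ ∪ Set.range j₂ = Set.univ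

variable {L : FirstOrder.Language.{u, v}}

/-- The members of a Fraïssé class. -/
abbrev FraisseClass.Obj (𝔉 : FraisseClass.{u, v, w} L) : Type _ := {X // X ∈ 𝔉.carrier}

variable {𝔉 : FraisseClass.{u, v, w} L}

/-- Embeddings between members of a Fraïssé class. -/
abbrev Emb (X Y : 𝔉.Obj) : Type w := X.1 ↪[L] Y.1

/-- The pair of embeddings `x`, `y` is jointly surjective. -/
def JointlySurj {X Y W : 𝔉.Obj} (x : Emb X W) (y : Emb Y W) : Prop :=
  ∀ z : W.1, (∃ a, x a = z) ∨ (∃ b, y b = z)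

/-- An amalgamation of `X` and `Y` with members in the class `𝔉`. -/
structure Amalgamation (X Y : 𝔉.Obj) where
  pt : 𝔉.Obj
  inl : Emb X pt
  inr : Emb Y pt
  surj : JointlySurj inl inr

/-- Isomorphism of amalgamations. -/
instance Amalgamation.setoid (X Y : 𝔉.Obj) : Setoid (Amalgamation X Y) where
  r A B := ∃ e : A.pt.1 ≃[L] B.pt.1,
    e.toEmbedding.comp A.inl = B.inl ∧ e.toEmbedding.comp A.inr = B.inr
  iseqv :=
    { refl := fun A => ⟨FirstOrder.Language.Equiv.refl L _, by ext; rfl, by ext; rfl⟩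
      symm := by
        rintro A B ⟨e, h1, h2⟩
        refine ⟨e.symm, ?_, ?_⟩
        · rw [← h1]; ext; simp
        · rw [← h2]; ext; simp
      trans := by
        rintro A B C ⟨e, h1, h2⟩ ⟨e', h1', h2'⟩
        refine ⟨e'.comp e, ?_, ?_⟩
        · rw [← h1', ← h1]; ext; simp
        · rw [← h2', ← h2]; ext; simp }

/-- The set of isomorphism classes of amalgamations of `X` and `Y` in `𝔉`. -/
def Amalg (X Y : 𝔉.Obj) : Type _ := Quotient (Amalgamation.setoid X Y)

namespace Amalg

variable {X Y : 𝔉.Obj}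

/-- A chosen representative of a class of amalgamations. -/
def rep (q : Amalg X Y) : Amalgamation X Y := Quotient.out q

/-- The underlying structure of the chosen representative. -/
abbrev pt (q : Amalg X Y) : 𝔉.Obj := q.rep.pt

/-- The first embedding of the chosen representative. -/
abbrev inl (q : Amalg X Y) : Emb X q.pt := q.rep.inl

/-- The second embedding of the chosen representative. -/
abbrev inr (q : Amalg X Y) : Emb Y q.pt := q.rep.inr

end Amalg

/-- The class of an amalgamation. -/
def Amalgamation.cls {X Y : 𝔉.Obj} (A : Amalgamation X Y) : Amalg X Y := Quotient.mk _ A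

/-- Isomorphism classes of amalgamations of `Y₁` and `Y₂` over `X`. (Whether the square commutes
does not depend on the representative.) -/
abbrev AmalgOver {X Y₁ Y₂ : 𝔉.Obj} (i₁ : Emb X Y₁) (i₂ : Emb X Y₂) : Type _ :=
  {q : Amalg Y₁ Y₂ // q.inl.comp i₁ = q.inr.comp i₂}

instance Amalg.finite (X Y : 𝔉.Obj) : Finite (Amalg X Y) := by
  classical
  have := 𝔉.finite X.1 X.2
  have := 𝔉.finite Y.1 Y.2
  choose S hS hrep using 𝔉.finitely_many
  let N := Nat.card X.1 + Nat.card Y.1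
  let U : Set (Bundled.{w} L.Structure) := {R | R ∈ ⋃ n ∈ Finset.range (N + 1), S n ∧ Finite R}
  have hU : U.Finite := by
    refine Set.Finite.subset (Set.Finite.biUnion (Finset.range (N+1)).finite_toSet
      (fun n _ => hS n)) ?_
    intro R hR
    exact hR.1
  have := hU.to_subtype
  have : ∀ R : U, Finite R.1 := fun R => R.2.2
  have key : ∀ q : Amalg X Y, ∃ R : U, Nonempty (q.pt.1 ≃[L] R.1) := by
    intro q
    have := 𝔉.finite q.pt.1 q.pt.2
    have hc : Nat.card q.pt.1 ≤ N := by
      have hs : Function.Surjective (Sum.elim q.inl q.inr : X.1 ⊕ Y.1 → q.pt.1) := by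
        intro z
        rcases q.rep.surj z with ⟨a, ha⟩ | ⟨b, hb⟩
        · exact ⟨Sum.inl a, ha⟩
        · exact ⟨Sum.inr b, hb⟩
      have := Nat.card_le_card_of_surjective _ hs
      rwa [Nat.card_sum] at this
    obtain ⟨R, hR, ⟨e⟩⟩ := hrep _ q.pt.1 q.pt.2 rfl
    refine ⟨⟨R, ?_, Finite.of_equiv _ e.toEquiv⟩, ⟨e⟩⟩
    simp only [Set.mem_iUnion]
    exact ⟨_, Finset.mem_range.2 (Nat.lt_succ_of_le hc), hR⟩
  choose R e using key
  let F : Amalg X Y → Σ R : U, (X.1 → R.1) × (Y.1 → R.1) := fun q =>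
    ⟨R q, fun a => (e q).some (q.inl a), fun b => (e q).some (q.inr b)⟩
  refine Finite.of_injective F ?_
  intro q q' h
  obtain ⟨E, hE⟩ : ∃ E : q.pt.1 ≃[L] (R q).1, E = (e q).some := ⟨_, rfl⟩
  obtain ⟨E', hE'⟩ : ∃ E : q'.pt.1 ≃[L] (R q').1, E = (e q').some := ⟨_, rfl⟩
  simp only [F, ← hE, ← hE'] at h
  clear hE hE'
  generalize R q = r1 at E h
  generalize R q' = r2 at E' h
  obtain rfl : r1 = r2 := congrArg Sigma.fst h
  simp only [Sigma.mk.injEq, heq_eq_eq, true_and, Prod.mk.injEq] at h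
  rw [← Quotient.out_eq q, ← Quotient.out_eq q']
  refine Quotient.sound ⟨E'.symm.comp E, ?_, ?_⟩
  · ext a
    have := congrFun h.1 a
    change E'.symm (E (q.inl a)) = q'.inl a
    rw [this]; simp
  · ext a
    have := congrFun h.2 a
    change E'.symm (E (q.inr a)) = q'.inr a
    rw [this]; simp

instance (X Y : 𝔉.Obj) : Fintype (Amalg X Y) := Fintype.ofFinite _

instance {X Y₁ Y₂ : 𝔉.Obj} (i₁ : Emb X Y₁) (i₂ : Emb X Y₂) : Finite (AmalgOver i₁ i₂) :=
  inferInstanceAs (Finite {q : Amalg Y₁ Y₂ // q.inl.comp i₁ = q.inr.comp i₂})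

instance {X Y₁ Y₂ : 𝔉.Obj} (i₁ : Emb X Y₁) (i₂ : Emb X Y₂) : Fintype (AmalgOver i₁ i₂) :=
  Fintype.ofFinite _

/-- A measure on the Fraïssé class `𝔉` with values in the commutative ring `k`: a rule assigning a
value to each embedding in `𝔉`, equal to `1` on isomorphisms, multiplicative, and such that
`μ(X → Y) = ∑ μ(X' → Y')`, the sum being over the amalgamations `Y'` of `X'` and `Y` over `X`. -/
structure Measure (𝔉 : FraisseClass.{u, v, w} L) (k : Type r) [CommRing k] where
  toFun : ∀ {X Y : 𝔉.Obj}, Emb X Y → k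
  map_equiv : ∀ {X Y : 𝔉.Obj} (e : X.1 ≃[L] Y.1), toFun (X := X) (Y := Y) e.toEmbedding = 1
  map_comp : ∀ {X Y Z : 𝔉.Obj} (i : Emb X Y) (j : Emb Y Z),
    toFun (X := X) (Y := Z) (j.comp i) = toFun j * toFun i
  map_amalg : ∀ {X Y X' : 𝔉.Obj} (i : Emb X Y) (j : Emb X X'),
    toFun i = ∑ q : AmalgOver j i, toFun q.1.inl

/-- A bijective embedding is an isomorphism. -/
def equivOfSurj {M N : Type w} [L.Structure M] [L.Structure N] (f : M ↪[L] N)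
    (h : Function.Surjective f) : M ≃[L] N :=
  { Equiv.ofBijective f ⟨f.injective, h⟩ with
    map_fun' := fun g x => f.map_fun g x
    map_rel' := fun g x => f.map_rel g x }

theorem equivOfSurj_toEmbedding {M N : Type w} [L.Structure M] [L.Structure N] (f : M ↪[L] N)
    (h : Function.Surjective f) : (equivOfSurj f h).toEmbedding = f := by
  ext; rfl

theorem JointlySurj.hom_ext {X Y W V : 𝔉.Obj} {x : Emb X W} {y : Emb Y W} (h : JointlySurj x y)
    {f g : Emb W V} (h1 : f.comp x = g.comp x) (h2 : f.comp y = g.comp y) : f = g := by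
  ext z
  rcases h z with ⟨a, rfl⟩ | ⟨a, rfl⟩
  · exact DFunLike.congr_fun h1 a
  · exact DFunLike.congr_fun h2 a

theorem JointlySurj.surjective {X Y W V : 𝔉.Obj} {x : Emb X W} {y : Emb Y W}
    {e : Emb V W} (h : JointlySurj x y) {x' : Emb X V} {y' : Emb Y V}
    (h1 : e.comp x' = x) (h2 : e.comp y' = y) : Function.Surjective e := by
  intro z
  rcases h z with ⟨a, ha⟩ | ⟨a, ha⟩
  · exact ⟨x' a, by rw [← ha, ← h1]; rfl⟩
  · exact ⟨y' a, by rw [← ha, ← h2]; rfl⟩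

variable [L.IsRelational]

/-- The substructure of `W` induced on the union of the images of `x` and `y`. -/
def imageSub {X Y W : 𝔉.Obj} (x : Emb X W) (y : Emb Y W) : L.Substructure W.1 where
  carrier := Set.range x ∪ Set.range y
  fun_mem := fun f => isEmptyElim f

/-- The joint image of two embeddings `x : X → W` and `y : Y → W`, as an amalgamation. -/
def image {X Y W : 𝔉.Obj} (x : Emb X W) (y : Emb Y W) : Amalgamation X Y where
  pt := ⟨Bundled.of (imageSub x y), 𝔉.hereditary W.1 W.2 _ ⟨(imageSub x y).subtype⟩⟩
  inl := x.codRestrict (imageSub x y) fun a => Or.inl ⟨a, rfl⟩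
  inr := y.codRestrict (imageSub x y) fun a => Or.inr ⟨a, rfl⟩
  surj := by
    rintro ⟨z, ⟨a, rfl⟩ | ⟨b, rfl⟩⟩
    · exact Or.inl ⟨a, rfl⟩
    · exact Or.inr ⟨b, rfl⟩

/-- The inclusion of the joint image. -/
def imageIncl {X Y W : 𝔉.Obj} (x : Emb X W) (y : Emb Y W) : Emb (image x y).pt W :=
  (imageSub x y).subtype

/-- The isomorphism class of the joint image of two embeddings. -/
def cls {X Y W : 𝔉.Obj} (x : Emb X W) (y : Emb Y W) : Amalg X Y := (image x y).cls

theorem imageIncl_inl {X Y W : 𝔉.Obj} (x : Emb X W) (y : Emb Y W) :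
    (imageIncl x y).comp (image x y).inl = x := by ext; rfl

theorem imageIncl_inr {X Y W : 𝔉.Obj} (x : Emb X W) (y : Emb Y W) :
    (imageIncl x y).comp (image x y).inr = y := by ext; rfl

theorem cls_mk {X Y W : 𝔉.Obj} (A : Amalgamation X Y) (e : Emb A.pt W) :
    cls (e.comp A.inl) (e.comp A.inr) = A.cls := by
  refine Quotient.sound (Setoid.symm ?_)
  let E : A.pt.1 ↪[L] (image (e.comp A.inl) (e.comp A.inr)).pt.1 :=
    e.codRestrict (imageSub (e.comp A.inl) (e.comp A.inr)) fun c => by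
      rcases A.surj c with ⟨a, rfl⟩ | ⟨a, rfl⟩
      · exact Or.inl ⟨a, rfl⟩
      · exact Or.inr ⟨a, rfl⟩
  have hE : Function.Surjective E := by
    rintro ⟨z, ⟨a, rfl⟩ | ⟨b, rfl⟩⟩
    · exact ⟨A.inl a, rfl⟩
    · exact ⟨A.inr b, rfl⟩
  exact ⟨equivOfSurj E hE, by ext; rfl, by ext; rfl⟩

theorem cls_comp {X Y W V : 𝔉.Obj} (f : Emb W V) (x : Emb X W) (y : Emb Y W) :
    cls (f.comp x) (f.comp y) = cls x y := by
  have := cls_mk (image x y) (f.comp (imageIncl x y))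
  rw [FirstOrder.Language.Embedding.comp_assoc, FirstOrder.Language.Embedding.comp_assoc,
    imageIncl_inl, imageIncl_inr] at this
  exact this

theorem cls_rep {X Y : 𝔉.Obj} (q : Amalg X Y) : cls q.inl q.inr = q := by
  have := cls_mk q.rep (FirstOrder.Language.Embedding.refl L _)
  rw [FirstOrder.Language.Embedding.refl_comp, FirstOrder.Language.Embedding.refl_comp] at this
  rw [this]
  exact Quotient.out_eq q

theorem exists_emb {X Y W V : 𝔉.Obj} {x : Emb X W} {y : Emb Y W} (h : JointlySurj x y)
    {x' : Emb X V} {y' : Emb Y V} (he : cls x y = cls x' y') :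
    ∃ e : Emb W V, e.comp x = x' ∧ e.comp y = y' := by
  obtain ⟨e, h1, h2⟩ := Quotient.exact he
  have hs : ∀ c : W.1, c ∈ imageSub x y := h
  let E : W.1 ↪[L] (image x y).pt.1 :=
    (FirstOrder.Language.Embedding.refl L W.1).codRestrict (imageSub x y) hs
  refine ⟨(imageIncl x' y').comp (e.toEmbedding.comp E), ?_, ?_⟩
  · conv_rhs => rw [← imageIncl_inl x' y', ← h1]
    rfl
  · conv_rhs => rw [← imageIncl_inr x' y', ← h2]
    rfl

theorem exists_lift {X Y W : 𝔉.Obj} (x : Emb X W) (y : Emb Y W) :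
    ∃ e : Emb (cls x y).pt W, e.comp (cls x y).inl = x ∧ e.comp (cls x y).inr = y :=
  exists_emb (cls x y).rep.surj (cls_rep _)

theorem cls_swap {X Y W W' : 𝔉.Obj} {x : Emb X W} {y : Emb Y W} {x' : Emb X W'}
    {y' : Emb Y W'} (h : cls x y = cls x' y') : cls y x = cls y' x' := by
  have key : ∀ (q : Amalg X Y) {V : 𝔉.Obj} {a : Emb X V} {b : Emb Y V} (e : Emb q.pt V),
      e.comp q.inl = a → e.comp q.inr = b → cls b a = cls q.inr q.inl := by
    rintro q V _ _ e rfl rfl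
    exact cls_comp _ _ _
  obtain ⟨e, h1, h2⟩ := exists_lift x y
  obtain ⟨e', h1', h2'⟩ := exists_emb (cls x y).rep.surj ((cls_rep (cls x y)).trans h)
  rw [key _ e h1 h2, key _ e' h1' h2']

set_option linter.unusedSectionVars false

theorem Emb.cancel {X Y Z : 𝔉.Obj} (e : Emb Y Z) {f g : Emb X Y} (h : e.comp f = e.comp g) :
    f = g := by
  ext a
  exact e.injective (DFunLike.congr_fun h a)

/-- An amalgamation of three structures: a structure with three jointly surjective embeddings. -/
structure Amalgamation₃ (X Y Z : 𝔉.Obj) where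
  pt : 𝔉.Obj
  i₁ : Emb X pt
  i₂ : Emb Y pt
  i₃ : Emb Z pt
  surj : ∀ t : pt.1, (∃ a, i₁ a = t) ∨ (∃ b, i₂ b = t) ∨ (∃ c, i₃ c = t)

/-- Isomorphism of amalgamations of three structures. -/
instance Amalgamation₃.setoid (X Y Z : 𝔉.Obj) : Setoid (Amalgamation₃ X Y Z) where
  r A B := ∃ e : A.pt.1 ≃[L] B.pt.1, e.toEmbedding.comp A.i₁ = B.i₁ ∧
    e.toEmbedding.comp A.i₂ = B.i₂ ∧ e.toEmbedding.comp A.i₃ = B.i₃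
  iseqv :=
    { refl := fun A => ⟨FirstOrder.Language.Equiv.refl L _, by ext; rfl, by ext; rfl, by ext; rfl⟩
      symm := by
        rintro A B ⟨e, h1, h2, h3⟩
        refine ⟨e.symm, ?_, ?_, ?_⟩
        · rw [← h1]; ext; simp
        · rw [← h2]; ext; simp
        · rw [← h3]; ext; simp
      trans := by
        rintro A B C ⟨e, h1, h2, h3⟩ ⟨e', h1', h2', h3'⟩
        refine ⟨e'.comp e, ?_, ?_, ?_⟩
        · rw [← h1', ← h1]; ext; simp
        · rw [← h2', ← h2]; ext; simp
        · rw [← h3', ← h3]; ext; simp }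

/-- Isomorphism classes of amalgamations of three structures. -/
def Amalg₃ (X Y Z : 𝔉.Obj) : Type _ := Quotient (Amalgamation₃.setoid X Y Z)

/-- A chosen representative of a class. -/
def Amalg₃.rep {X Y Z : 𝔉.Obj} (T : Amalg₃ X Y Z) : Amalgamation₃ X Y Z := Quotient.out T

theorem Amalg₃.mk_rep {X Y Z : 𝔉.Obj} (T : Amalg₃ X Y Z) : Quotient.mk _ T.rep = T :=
  Quotient.out_eq T

/-- An amalgamation of `X`, `Y`, `Z` from iterated amalgamations. -/
def assemble {X Y Z : 𝔉.Obj} (p : Σ q : Amalg X Y, Amalg q.pt Z) : Amalgamation₃ X Y Z where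
  pt := p.2.pt
  i₁ := p.2.inl.comp p.1.inl
  i₂ := p.2.inl.comp p.1.inr
  i₃ := p.2.inr
  surj := fun t => by
    rcases p.2.rep.surj t with ⟨a, rfl⟩ | ⟨c, rfl⟩
    · rcases p.1.rep.surj a with ⟨a, rfl⟩ | ⟨b, rfl⟩
      · exact Or.inl ⟨a, rfl⟩
      · exact Or.inr (Or.inl ⟨b, rfl⟩)
    · exact Or.inr (Or.inr ⟨c, rfl⟩)

theorem assemble_bijective (X Y Z : 𝔉.Obj) : Function.Bijective
    (fun p : (Σ q : Amalg X Y, Amalg q.pt Z) => (Quotient.mk _ (assemble p) : Amalg₃ X Y Z)) := by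
  constructor
  · rintro ⟨q, r⟩ ⟨q', r'⟩ h
    obtain ⟨e, h1, h2, h3⟩ := Quotient.exact h
    simp only [assemble] at e h1 h2 h3
    have hq : q = q' := by
      rw [← cls_rep q, ← cls_rep q', ← cls_comp r.inl q.inl q.inr,
        ← cls_comp r'.inl q'.inl q'.inr, ← h1, ← h2]
      exact (cls_comp (W := r.pt) (V := r'.pt) e.toEmbedding _ _).symm
    subst hq
    have hr : r = r' := by
      have h4 : e.toEmbedding.comp r.inl = r'.inl :=
        q.rep.surj.hom_ext (W := q.pt) (V := r'.pt) (f := e.toEmbedding.comp r.inl)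
          (g := r'.inl) h1 h2
      rw [← cls_rep r, ← cls_rep r', ← h4, ← h3]
      exact (cls_comp (W := r.pt) (V := r'.pt) e.toEmbedding _ _).symm
    subst hr
    rfl
  · intro T
    obtain ⟨t, rfl⟩ := Quotient.exists_rep T
    obtain ⟨e, h1, h2⟩ := exists_lift t.i₁ t.i₂
    obtain ⟨e', h1', h2'⟩ := exists_lift e t.i₃
    refine ⟨⟨cls t.i₁ t.i₂, cls e t.i₃⟩, Quotient.sound ?_⟩
    have hs : Function.Surjective e' := by
      intro z
      rcases t.surj z with ⟨a, rfl⟩ | ⟨a, rfl⟩ | ⟨a, rfl⟩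
      · exact ⟨(cls e t.i₃).inl ((cls t.i₁ t.i₂).inl a), by
          conv_rhs => rw [← h1, ← h1']
          rfl⟩
      · exact ⟨(cls e t.i₃).inl ((cls t.i₁ t.i₂).inr a), by
          conv_rhs => rw [← h2, ← h1']
          rfl⟩
      · exact ⟨(cls e t.i₃).inr a, by
          conv_rhs => rw [← h2']
          rfl⟩
    have k1 : e'.comp ((cls e t.i₃).inl.comp (cls t.i₁ t.i₂).inl) = t.i₁ := by
      rw [← FirstOrder.Language.Embedding.comp_assoc, h1', h1]
    have k2 : e'.comp ((cls e t.i₃).inl.comp (cls t.i₁ t.i₂).inr) = t.i₂ := by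
      rw [← FirstOrder.Language.Embedding.comp_assoc, h1', h2]
    exact ⟨equivOfSurj e' hs, k1, k2, h2'⟩

instance Amalg₃.finite (X Y Z : 𝔉.Obj) : Finite (Amalg₃ X Y Z) :=
  Finite.of_surjective _ (assemble_bijective X Y Z).2

instance (X Y Z : 𝔉.Obj) : Fintype (Amalg₃ X Y Z) := Fintype.ofFinite _

variable {k : Type r} [CommRing k]

/-- The sum over all amalgamations of three structures. -/
def sum₃ (X Y Z : 𝔉.Obj) (F : ∀ V : 𝔉.Obj, Emb X V → Emb Y V → Emb Z V → k) : k :=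
  ∑ T : Amalg₃ X Y Z, F T.rep.pt T.rep.i₁ T.rep.i₂ T.rep.i₃

/-- Invariance under isomorphisms. -/
def IsoInv₃ {X Y Z : 𝔉.Obj} (F : ∀ V : 𝔉.Obj, Emb X V → Emb Y V → Emb Z V → k) : Prop :=
  ∀ (V V' : 𝔉.Obj) (e : Emb V V'), Function.Surjective e → ∀ a b c,
    F V' (e.comp a) (e.comp b) (e.comp c) = F V a b c

theorem IsoInv₃.rep_mk {X Y Z : 𝔉.Obj}
    {F : ∀ V : 𝔉.Obj, Emb X V → Emb Y V → Emb Z V → k} (hF : IsoInv₃ F)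
    (t : Amalgamation₃ X Y Z) :
    F (Amalg₃.rep (Quotient.mk _ t)).pt (Amalg₃.rep (Quotient.mk _ t)).i₁
      (Amalg₃.rep (Quotient.mk _ t)).i₂ (Amalg₃.rep (Quotient.mk _ t)).i₃
      = F t.pt t.i₁ t.i₂ t.i₃ := by
  obtain ⟨e, h1, h2, h3⟩ := Quotient.exact (Amalg₃.mk_rep (Quotient.mk _ t))
  rw [← h1, ← h2, ← h3]
  exact (hF _ _ e.toEmbedding e.surjective _ _ _).symm

theorem sum₃_eq {X Y Z : 𝔉.Obj} {F : ∀ V : 𝔉.Obj, Emb X V → Emb Y V → Emb Z V → k}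
    (hF : IsoInv₃ F) :
    sum₃ X Y Z F = ∑ q : Amalg X Y, ∑ s : Amalg q.pt Z,
      F s.pt (s.inl.comp q.inl) (s.inl.comp q.inr) s.inr := by
  rw [← Fintype.sum_sigma' (fun (q : Amalg X Y) (s : Amalg q.pt Z) =>
    F s.pt (s.inl.comp q.inl) (s.inl.comp q.inr) s.inr)]
  symm
  refine Fintype.sum_bijective (κ := Amalg₃ X Y Z) (fun p => Quotient.mk _ (assemble p))
    (assemble_bijective X Y Z) _ _ ?_
  intro p
  exact (hF.rep_mk (assemble p)).symm

theorem sum₃_swap12 {X Y Z : 𝔉.Obj} {F : ∀ V : 𝔉.Obj, Emb X V → Emb Y V → Emb Z V → k}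
    (hF : IsoInv₃ F) :
    sum₃ X Y Z F = sum₃ Y X Z (fun V b a c => F V a b c) := by
  let sw : ∀ X Y Z : 𝔉.Obj, Amalg₃ X Y Z → Amalg₃ Y X Z := fun X Y Z =>
    Quotient.map (fun t => ⟨t.pt, t.i₂, t.i₁, t.i₃, fun z => by
        have := t.surj z
        tauto⟩)
      (by rintro a b ⟨e, h1, h2, h3⟩; exact ⟨e, h2, h1, h3⟩)
  have hsw : ∀ X Y Z T, sw Y X Z (sw X Y Z T) = T := by
    rintro X Y Z ⟨t⟩; rfl
  refine Fintype.sum_equiv ⟨sw X Y Z, sw Y X Z, hsw _ _ _, hsw _ _ _⟩ _ _ ?_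
  intro T
  obtain ⟨t, rfl⟩ := Quotient.exists_rep T
  have hF' : IsoInv₃ (fun (V : 𝔉.Obj) (b : Emb Y V) (a : Emb X V) (c : Emb Z V) => F V a b c) :=
    fun V V' e he a b c => hF V V' e he b a c
  rw [hF.rep_mk t]
  exact (hF'.rep_mk ⟨t.pt, t.i₂, t.i₁, t.i₃, _⟩).symm

theorem sum₃_swap23 {X Y Z : 𝔉.Obj} {F : ∀ V : 𝔉.Obj, Emb X V → Emb Y V → Emb Z V → k}
    (hF : IsoInv₃ F) :
    sum₃ X Y Z F = sum₃ X Z Y (fun V a c b => F V a b c) := by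
  let sw : ∀ X Y Z : 𝔉.Obj, Amalg₃ X Y Z → Amalg₃ X Z Y := fun X Y Z =>
    Quotient.map (fun t => ⟨t.pt, t.i₁, t.i₃, t.i₂, fun z => by
        have := t.surj z
        tauto⟩)
      (by rintro a b ⟨e, h1, h2, h3⟩; exact ⟨e, h1, h3, h2⟩)
  have hsw : ∀ X Y Z T, sw X Z Y (sw X Y Z T) = T := by
    rintro X Y Z ⟨t⟩; rfl
  refine Fintype.sum_equiv ⟨sw X Y Z, sw X Z Y, hsw _ _ _, hsw _ _ _⟩ _ _ ?_
  intro T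
  obtain ⟨t, rfl⟩ := Quotient.exists_rep T
  have hF' : IsoInv₃ (fun (V : 𝔉.Obj) (a : Emb X V) (c : Emb Z V) (b : Emb Y V) => F V a b c) :=
    fun V V' e he a b c => hF V V' e he a c b
  rw [hF.rep_mk t]
  exact (hF'.rep_mk ⟨t.pt, t.i₁, t.i₃, t.i₂, _⟩).symm

theorem sum₂_swap {X Y : 𝔉.Obj} {F : ∀ V : 𝔉.Obj, Emb X V → Emb Y V → k}
    (hF : ∀ (V V' : 𝔉.Obj) (e : Emb V V'), Function.Surjective e → ∀ a b,
      F V' (e.comp a) (e.comp b) = F V a b) :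
    ∑ q : Amalg X Y, F q.pt q.inl q.inr = ∑ q : Amalg Y X, F q.pt q.inr q.inl := by
  have hsw : ∀ (X Y : 𝔉.Obj) (q : Amalg X Y),
      cls (cls q.inr q.inl).inr (cls q.inr q.inl).inl = q := by
    intro X Y q
    rw [cls_swap (cls_rep (cls q.inr q.inl)), cls_rep]
  have hb : Function.Bijective (fun q : Amalg X Y => cls q.inr q.inl) :=
    Function.bijective_iff_has_inverse.2 ⟨fun q => cls q.inr q.inl, hsw X Y, hsw Y X⟩
  have hv : ∀ q : Amalg X Y,
      F q.pt q.inl q.inr = F (cls q.inr q.inl).pt (cls q.inr q.inl).inr (cls q.inr q.inl).inl := by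
    intro q
    obtain ⟨e, h1, h2⟩ := exists_lift q.inr q.inl
    have h3 := hF (cls q.inr q.inl).pt q.pt e (q.rep.surj.surjective h2 h1)
      (cls q.inr q.inl).inr (cls q.inr q.inl).inl
    rw [h1, h2] at h3
    exact h3
  exact Fintype.sum_bijective (fun q : Amalg X Y => cls q.inr q.inl) hb
    (fun q => F q.pt q.inl q.inr) (fun q => F q.pt q.inr q.inl) hv

namespace Measure

variable (μ : Measure 𝔉 k)

theorem map_surj {X Y : 𝔉.Obj} (e : Emb X Y) (h : Function.Surjective e) : μ.toFun e = 1 := by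
  rw [← μ.map_equiv (equivOfSurj e h), equivOfSurj_toEmbedding]

/-- Integration over the embeddings of `Y`, relative to `W`. -/
def integ (W Y : 𝔉.Obj) (φ : ∀ V : 𝔉.Obj, Emb W V → Emb Y V → k) : k :=
  ∑ q : Amalg W Y, μ.toFun q.inl * φ q.pt q.inl q.inr

end Measure

/-- Compatibility of a function of two embeddings with all embeddings. -/
def Natural₂ {X Y : 𝔉.Obj} (F : ∀ V : 𝔉.Obj, Emb X V → Emb Y V → k) : Prop :=
  ∀ (V V' : 𝔉.Obj) (e : Emb V V') a b, F V' (e.comp a) (e.comp b) = F V a b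

/-- Compatibility of a function of three embeddings with all embeddings. -/
def Natural₃ {X Y Z : 𝔉.Obj}
    (F : ∀ V : 𝔉.Obj, Emb X V → Emb Y V → Emb Z V → k) : Prop :=
  ∀ (V V' : 𝔉.Obj) (e : Emb V V') a b c,
    F V' (e.comp a) (e.comp b) (e.comp c) = F V a b c

namespace Measure

variable (μ : Measure 𝔉 k)

theorem integ_base {W W' Y : 𝔉.Obj} (g : Emb W W') {φ : ∀ V : 𝔉.Obj, Emb W V → Emb Y V → k}
    (hφ : Natural₂ φ) :
    μ.integ W' Y (fun V f y => φ V (f.comp g) y) = μ.integ W Y φ := by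
  classical
  unfold integ
  rw [← Finset.sum_fiberwise Finset.univ
    (fun q : Amalg W' Y => cls (q.inl.comp g) q.inr)]
  refine Finset.sum_congr rfl fun s _ => ?_
  rw [μ.map_amalg s.inl g, Finset.sum_mul]
  symm
  have js : ∀ p : AmalgOver g s.inl, JointlySurj p.1.inl (p.1.inr.comp s.inr) := by
    intro p z
    rcases p.1.rep.surj z with ⟨a, rfl⟩ | ⟨b, rfl⟩
    · exact Or.inl ⟨a, rfl⟩
    · rcases s.rep.surj b with ⟨c, rfl⟩ | ⟨c, rfl⟩
      · exact Or.inl ⟨g c, DFunLike.congr_fun p.2 c⟩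
      · exact Or.inr ⟨c, rfl⟩
  refine Finset.sum_bij (fun p _ => cls p.1.inl (p.1.inr.comp s.inr)) ?_ ?_ ?_ ?_
  · intro p _
    simp only [Finset.mem_filter, Finset.mem_univ, true_and]
    obtain ⟨e, h1, h2⟩ := exists_lift p.1.inl (p.1.inr.comp s.inr)
    rw [← cls_comp e, ← FirstOrder.Language.Embedding.comp_assoc, h1, h2, p.2, cls_comp, cls_rep]
  · intro p _ p' _ h
    obtain ⟨e, h1, h2⟩ := exists_emb (js p) h
    have h3 : e.comp p.1.inr = p'.1.inr := by
      refine s.rep.surj.hom_ext ?_ ?_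
      · change (e.comp p.1.inr).comp s.inl = p'.1.inr.comp s.inl
        rw [← p'.2, ← h1, FirstOrder.Language.Embedding.comp_assoc,
          FirstOrder.Language.Embedding.comp_assoc, p.2]
      · rw [FirstOrder.Language.Embedding.comp_assoc]
        exact h2
    apply Subtype.ext
    rw [← cls_rep p.1, ← cls_rep p'.1, ← h1, ← h3, cls_comp]
  · intro q hq
    simp only [Finset.mem_filter, Finset.mem_univ, true_and] at hq
    obtain ⟨z, h1, h2⟩ := exists_emb s.rep.surj ((cls_rep s).trans hq.symm)
    obtain ⟨e, h3, h4⟩ := exists_lift q.inl z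
    refine ⟨⟨cls q.inl z, ?_⟩, Finset.mem_univ _, ?_⟩
    · apply e.cancel
      rw [← FirstOrder.Language.Embedding.comp_assoc, ← FirstOrder.Language.Embedding.comp_assoc,
        h3, h4]
      exact h1.symm
    · change cls (cls q.inl z).inl ((cls q.inl z).inr.comp s.inr) = q
      rw [← cls_comp e, ← FirstOrder.Language.Embedding.comp_assoc, h3, h4]
      conv_rhs => rw [← cls_rep q]
      rw [← h2]
  · intro p _
    obtain ⟨e, h1, h2⟩ := exists_lift p.1.inl (p.1.inr.comp s.inr)
    have hs := (js p).surjective h1 h2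
    have h5 := μ.map_comp (cls p.1.inl (p.1.inr.comp s.inr)).inl e
    rw [h1, μ.map_surj e hs, one_mul] at h5
    change _ = μ.toFun _ * φ _ ((cls p.1.inl (p.1.inr.comp s.inr)).inl.comp g)
      (cls p.1.inl (p.1.inr.comp s.inr)).inr
    rw [h5, ← hφ _ _ p.1.inr, ← hφ _ _ e, ← FirstOrder.Language.Embedding.comp_assoc, h1, h2, p.2]

theorem integ_congr {W Y : 𝔉.Obj} {φ ψ : ∀ V : 𝔉.Obj, Emb W V → Emb Y V → k}
    (h : ∀ V f y, φ V f y = ψ V f y) : μ.integ W Y φ = μ.integ W Y ψ := by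
  have : φ = ψ := by
    funext V f y
    exact h V f y
  rw [this]

theorem integ_mul {W Y : 𝔉.Obj} (c : k) (φ : ∀ V : 𝔉.Obj, Emb W V → Emb Y V → k) :
    μ.integ W Y (fun V f y => c * φ V f y) = c * μ.integ W Y φ := by
  unfold integ
  rw [Finset.mul_sum]
  exact Finset.sum_congr rfl fun q _ => by ring

theorem integ_sum {W Y : 𝔉.Obj} {ι : Type*} [Fintype ι]
    (φ : ι → ∀ V : 𝔉.Obj, Emb W V → Emb Y V → k) :
    μ.integ W Y (fun V f y => ∑ i, φ i V f y) = ∑ i, μ.integ W Y (φ i) := by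
  unfold integ
  rw [Finset.sum_comm]
  exact Finset.sum_congr rfl fun q _ => by rw [Finset.mul_sum]

theorem isoInv {W Y Z : 𝔉.Obj} {ψ : ∀ V : 𝔉.Obj, Emb W V → Emb Y V → Emb Z V → k}
    (hψ : Natural₃ ψ) : IsoInv₃ (fun (V : 𝔉.Obj) f y z => μ.toFun (Y := V) f * ψ V f y z) := by
  intro V V' e he a b c
  beta_reduce
  rw [hψ, μ.map_comp, μ.map_surj e he, one_mul]

theorem integ_integ {W Y Z : 𝔉.Obj} {ψ : ∀ V : 𝔉.Obj, Emb W V → Emb Y V → Emb Z V → k}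
    (hψ : Natural₃ ψ) :
    μ.integ W Y (fun V f y => μ.integ V Z (fun V' g z => ψ V' (g.comp f) (g.comp y) z)) =
      sum₃ W Y Z (fun V f y z => μ.toFun f * ψ V f y z) := by
  rw [sum₃_eq (μ.isoInv hψ)]
  unfold integ
  refine Finset.sum_congr rfl fun q _ => ?_
  rw [Finset.mul_sum]
  refine Finset.sum_congr rfl fun s _ => ?_
  rw [μ.map_comp]
  ring

theorem integ_comm {W Y Z : 𝔉.Obj} {ψ : ∀ V : 𝔉.Obj, Emb W V → Emb Y V → Emb Z V → k}
    (hψ : Natural₃ ψ) :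
    μ.integ W Y (fun V f y => μ.integ V Z (fun V' g z => ψ V' (g.comp f) (g.comp y) z)) =
    μ.integ W Z (fun V f z => μ.integ V Y (fun V' g y => ψ V' (g.comp f) y (g.comp z))) := by
  rw [μ.integ_integ hψ, sum₃_swap23 (μ.isoInv hψ)]
  exact (μ.integ_integ (ψ := fun V f z y => ψ V f y z)
    (fun V V' e a b c => hψ V V' e a c b)).symm

theorem integ_tensor {W Y Z : 𝔉.Obj} {ψ : ∀ V : 𝔉.Obj, Emb W V → Emb Y V → Emb Z V → k}
    (hψ : Natural₃ ψ) :
    ∑ q : Amalg Y Z, μ.integ W q.pt (fun V f t => ψ V f (t.comp q.inl) (t.comp q.inr)) =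
    μ.integ W Y (fun V f y => μ.integ V Z (fun V' g z => ψ V' (g.comp f) (g.comp y) z)) := by
  have h1 := μ.isoInv hψ
  have h2 : IsoInv₃ (fun (V : 𝔉.Obj) (y : Emb Y V) (f : Emb W V) (z : Emb Z V) =>
    μ.toFun (Y := V) f * ψ V f y z) := fun V V' e he a b c => h1 V V' e he b a c
  have h3 : IsoInv₃ (fun (V : 𝔉.Obj) (y : Emb Y V) (z : Emb Z V) (f : Emb W V) =>
    μ.toFun (Y := V) f * ψ V f y z) := fun V V' e he a b c => h1 V V' e he c a b
  rw [μ.integ_integ hψ, sum₃_swap12 h1, sum₃_swap23 h2, sum₃_eq h3]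
  refine Finset.sum_congr rfl fun q _ => ?_
  unfold integ
  refine sum₂_swap (F := fun (V : 𝔉.Obj) (f : Emb W V) (t : Emb q.pt V) =>
    μ.toFun f * ψ V f (t.comp q.inl) (t.comp q.inr)) ?_
  intro V V' e he a b
  exact h1 V V' e he a (b.comp q.inl) (b.comp q.inr)

theorem integ_delta {W Y : 𝔉.Obj} {φ : ∀ V : 𝔉.Obj, Emb W V → Emb Y V → k}
    (hφ : Natural₂ φ) (y₀ : Emb Y W) (h : ∀ V f y, y ≠ f.comp y₀ → φ V f y = 0) :
    μ.integ W Y φ = φ W (FirstOrder.Language.Embedding.refl L W.1) y₀ := by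
  have hj : JointlySurj (FirstOrder.Language.Embedding.refl L W.1 : Emb W W) y₀ :=
    fun z => Or.inl ⟨z, rfl⟩
  obtain ⟨e, h1, h2⟩ := exists_lift (FirstOrder.Language.Embedding.refl L W.1 : Emb W W) y₀
  have he := hj.surjective h1 h2
  have h5 := μ.map_comp (cls (FirstOrder.Language.Embedding.refl L W.1 : Emb W W) y₀).inl e
  rw [h1, μ.map_surj e he, one_mul, μ.map_surj _ (fun z => ⟨z, rfl⟩)] at h5
  unfold integ
  rw [Finset.sum_eq_single (cls (FirstOrder.Language.Embedding.refl L W.1 : Emb W W) y₀)]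
  · rw [← h5, one_mul, ← hφ _ _ e, h1, h2]
  · intro q _ hq
    rw [h, mul_zero]
    intro hc
    apply hq
    rw [← cls_rep q, hc]
    conv_lhs => rw [← FirstOrder.Language.Embedding.comp_refl q.inl]
    exact cls_comp q.inl _ _
  · intro hc
    exact absurd (Finset.mem_univ _) hc

theorem integ_delta_zero {W Y : 𝔉.Obj} {φ : ∀ V : 𝔉.Obj, Emb W V → Emb Y V → k}
    (h : ∀ V f y, φ V f y = 0) : μ.integ W Y φ = 0 := by
  unfold integ
  exact Finset.sum_eq_zero fun q _ => by rw [h, mul_zero]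

end Measure

/-- The category `Perm⁰`: its objects `Vec_X` are the members `X` of the Fraïssé class. -/
structure Perm₀ (μ : Measure 𝔉 k) where
  obj : 𝔉.Obj

namespace Perm₀

variable {μ : Measure 𝔉 k}

/-- Morphisms `Vec_X → Vec_Y` form the free module on the amalgamations of `X` and `Y`. -/
abbrev Hom (X Y : Perm₀ μ) : Type _ := Amalg X.obj Y.obj →₀ k

/-- The identity morphism is `X`, regarded as an amalgamation of `X` and `X`. -/
def id (X : Perm₀ μ) : Hom X X :=
  Finsupp.single (cls (FirstOrder.Language.Embedding.refl L X.obj.1 : Emb X.obj X.obj)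
    (FirstOrder.Language.Embedding.refl L X.obj.1 : Emb X.obj X.obj)) 1

/-- Composition: the bilinear extension of `φ_{Y₂} ∘ φ_{Y₁} = ∑_Z μ(Y₃ → Z) φ_{Y₃}`, the sum being
over the amalgamations `Z` of `X₁`, `X₂`, `X₃` in which the joint image of `X₁`, `X₂` is `Y₁` and
the joint image of `X₂`, `X₃` is `Y₂`; here `Y₃` is the joint image of `X₁`, `X₃`. -/
def comp {X₁ X₂ X₃ : Perm₀ μ} (f : Hom X₁ X₂) (g : Hom X₂ X₃) : Hom X₁ X₃ :=
  ∑ Z : Amalg₃ X₁.obj X₂.obj X₃.obj,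
    Finsupp.single (cls Z.rep.i₁ Z.rep.i₃)
      (f (cls Z.rep.i₁ Z.rep.i₂) * g (cls Z.rep.i₂ Z.rep.i₃) *
        μ.toFun (imageIncl Z.rep.i₁ Z.rep.i₃))

/-- The value of a morphism on a pair of embeddings: the coefficient of the joint image. -/
def val {X Y : Perm₀ μ} (f : Hom X Y) (W : 𝔉.Obj) (x : Emb X.obj W) (y : Emb Y.obj W) : k :=
  f (cls x y)

theorem val_natural {X Y : Perm₀ μ} (f : Hom X Y) : Natural₂ (val f) := by
  intro V V' e a b
  unfold val
  rw [cls_comp]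

theorem val_ext {X Y : Perm₀ μ} {f g : Hom X Y} (h : ∀ W x y, val f W x y = val g W x y) :
    f = g := by
  refine Finsupp.ext fun q => ?_
  have := h q.pt q.inl q.inr
  unfold val at this
  rwa [cls_rep] at this

theorem val_id (X : Perm₀ μ) (W : 𝔉.Obj) (x y : Emb X.obj W) [Decidable (x = y)] :
    val (id X) W x y = if x = y then 1 else 0 := by
  classical
  have hj : JointlySurj (FirstOrder.Language.Embedding.refl L X.obj.1 : Emb X.obj X.obj)
    (FirstOrder.Language.Embedding.refl L X.obj.1 : Emb X.obj X.obj) := fun z => Or.inl ⟨z, rfl⟩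
  unfold val id
  rw [Finsupp.single_apply]
  congr 1
  apply propext
  constructor
  · intro h
    obtain ⟨e, h1, h2⟩ := exists_emb hj h
    rw [← h1, ← h2]
  · rintro rfl
    exact (cls_comp x _ _).symm

theorem mul_natural {X Y Z : Perm₀ μ} (f : Hom X Y) (g : Hom Y Z) {W : 𝔉.Obj}
    (x : Emb X.obj W) (z : Emb Z.obj W) :
    Natural₂ (fun (V : 𝔉.Obj) (i : Emb W V) (y : Emb Y.obj V) =>
      val f V (i.comp x) y * val g V y (i.comp z)) := by
  intro V V' e a b
  beta_reduce
  rw [← val_natural f V V' e, ← val_natural g V V' e]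
  rfl

theorem val_comp {X Y Z : Perm₀ μ} (f : Hom X Y) (g : Hom Y Z) (W : 𝔉.Obj)
    (x : Emb X.obj W) (z : Emb Z.obj W) :
    val (comp f g) W x z = μ.integ W Y.obj
      (fun V i y => val f V (i.comp x) y * val g V y (i.comp z)) := by
  classical
  obtain ⟨e, h1, h2⟩ := exists_lift x z
  generalize hq : cls x z = q at e h1 h2
  have hF : IsoInv₃ (fun (V : 𝔉.Obj) (a : Emb X.obj V) (b : Emb Y.obj V) (c : Emb Z.obj V) =>
      if cls a c = q then f (cls a b) * g (cls b c) * μ.toFun (imageIncl a c) else 0) := by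
    intro V V' t ht a b c
    beta_reduce
    rw [cls_comp, cls_comp, cls_comp]
    congr 2
    obtain ⟨s, h1, h2⟩ := exists_emb (image (t.comp a) (t.comp c)).surj
      (y' := (image a c).inr) (x' := (image a c).inl) (by
        rw [← cls_comp (imageIncl (t.comp a) (t.comp c)), ← cls_comp (imageIncl a c),
          imageIncl_inl, imageIncl_inr, imageIncl_inl, imageIncl_inr, cls_comp])
    have hs := (image a c).surj.surjective h1 h2
    have h3 : imageIncl (t.comp a) (t.comp c) = (t.comp (imageIncl a c)).comp s := by
      refine (image (t.comp a) (t.comp c)).surj.hom_ext ?_ ?_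
      · rw [imageIncl_inl, FirstOrder.Language.Embedding.comp_assoc,
          FirstOrder.Language.Embedding.comp_assoc, h1, imageIncl_inl]
      · rw [imageIncl_inr, FirstOrder.Language.Embedding.comp_assoc,
          FirstOrder.Language.Embedding.comp_assoc, h2, imageIncl_inr]
    rw [h3, μ.map_comp (X := (image (t.comp a) (t.comp c)).pt) (Y := (image a c).pt) s,
      μ.map_comp (imageIncl a c) t, μ.map_surj s hs, μ.map_surj t ht, one_mul, mul_one]
  have hL : val (comp f g) W x z = sum₃ X.obj Y.obj Z.obj (fun V a b c =>
      if cls a c = q then f (cls a b) * g (cls b c) * μ.toFun (imageIncl a c) else 0) := by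
    unfold val comp sum₃
    rw [hq, Finsupp.finsetSum_apply]
    refine Finset.sum_congr rfl fun T _ => ?_
    rw [Finsupp.single_apply]
  have hF' : IsoInv₃ (fun (V : 𝔉.Obj) (a : Emb X.obj V) (c : Emb Z.obj V) (b : Emb Y.obj V) =>
      if cls a c = q then f (cls a b) * g (cls b c) * μ.toFun (imageIncl a c) else 0) :=
    fun V V' e he a b c => hF V V' e he a c b
  rw [hL, sum₃_swap23 hF, sum₃_eq hF', Finset.sum_eq_single q]
  · rw [← h1, ← h2]
    have := μ.integ_base e (mul_natural f g q.inl q.inr)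
    simp only [FirstOrder.Language.Embedding.comp_assoc] at this
    rw [this]
    unfold Measure.integ
    refine Finset.sum_congr rfl fun s _ => ?_
    rw [cls_comp, cls_rep, if_pos rfl, mul_comm]
    unfold val
    congr 1
    obtain ⟨t, h3, h4⟩ := exists_emb q.rep.surj
      (y' := (image (s.inl.comp q.inl) (s.inl.comp q.inr)).inr)
      (x' := (image (s.inl.comp q.inl) (s.inl.comp q.inr)).inl) (by
        rw [← cls_comp (imageIncl (s.inl.comp q.inl) (s.inl.comp q.inr)),
          imageIncl_inl, imageIncl_inr, cls_comp])
    have ht := (image (s.inl.comp q.inl) (s.inl.comp q.inr)).surj.surjective h3 h4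
    have h5 : s.inl = (imageIncl (s.inl.comp q.inl) (s.inl.comp q.inr)).comp t := by
      refine q.rep.surj.hom_ext ?_ ?_
      · rw [FirstOrder.Language.Embedding.comp_assoc, h3, imageIncl_inl]
      · rw [FirstOrder.Language.Embedding.comp_assoc, h4, imageIncl_inr]
    have h6 := μ.map_comp t (imageIncl (s.inl.comp q.inl) (s.inl.comp q.inr))
    rw [μ.map_surj t ht, mul_one, ← h5] at h6
    exact h6.symm
  · intro p _ hp
    refine Finset.sum_eq_zero fun s _ => ?_
    rw [cls_comp, cls_rep, if_neg hp]
  · intro h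
    exact absurd (Finset.mem_univ _) h

theorem id_comp' {X Y : Perm₀ μ} (f : Hom X Y) : comp (id X) f = f := by
  classical
  refine val_ext fun W x y => ?_
  rw [val_comp, μ.integ_delta (mul_natural _ _ x y) x]
  · rw [val_id, FirstOrder.Language.Embedding.refl_comp, if_pos rfl, one_mul,
      FirstOrder.Language.Embedding.refl_comp]
  · intro V i t ht
    rw [val_id, if_neg (Ne.symm ht), zero_mul]

theorem comp_id' {X Y : Perm₀ μ} (f : Hom X Y) : comp f (id Y) = f := by
  classical
  refine val_ext fun W x y => ?_
  rw [val_comp, μ.integ_delta (mul_natural _ _ x y) y]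
  · rw [val_id, FirstOrder.Language.Embedding.refl_comp,
      FirstOrder.Language.Embedding.refl_comp, if_pos rfl, mul_one]
  · intro V i t ht
    rw [val_id, if_neg ht, mul_zero]

theorem assoc' {X Y Z T : Perm₀ μ} (f : Hom X Y) (g : Hom Y Z) (h : Hom Z T) :
    comp (comp f g) h = comp f (comp g h) := by
  refine val_ext fun W x t => ?_
  have key : Natural₃ (fun (V : 𝔉.Obj) (i : Emb W V) (z : Emb Z.obj V) (y : Emb Y.obj V) =>
      val f V (i.comp x) y * val g V y z * val h V z (i.comp t)) := by
    intro V V' e a b c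
    beta_reduce
    rw [← val_natural f V V' e, ← val_natural g V V' e, ← val_natural h V V' e]
    rfl
  have h1 : val (comp (comp f g) h) W x t = μ.integ W Z.obj (fun V i z =>
      μ.integ V Y.obj (fun V' j y =>
        val f V' ((j.comp i).comp x) y * val g V' y (j.comp z) *
          val h V' (j.comp z) ((j.comp i).comp t))) := by
    rw [val_comp]
    refine μ.integ_congr fun V i z => ?_
    rw [val_comp, mul_comm, ← μ.integ_mul]
    refine μ.integ_congr fun V' j y => ?_
    rw [← val_natural h V V' j, FirstOrder.Language.Embedding.comp_assoc,
      FirstOrder.Language.Embedding.comp_assoc, mul_comm]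
  have h2 : val (comp f (comp g h)) W x t = μ.integ W Y.obj (fun V i y =>
      μ.integ V Z.obj (fun V' j z =>
        val f V' ((j.comp i).comp x) (j.comp y) * val g V' (j.comp y) z *
          val h V' z ((j.comp i).comp t))) := by
    rw [val_comp]
    refine μ.integ_congr fun V i y => ?_
    rw [val_comp, ← μ.integ_mul]
    refine μ.integ_congr fun V' j z => ?_
    rw [← val_natural f V V' j, FirstOrder.Language.Embedding.comp_assoc,
      FirstOrder.Language.Embedding.comp_assoc, mul_assoc]
  rw [h1, h2]
  exact μ.integ_comm key

instance : Category (Perm₀ μ) where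
  Hom := Hom
  id := id
  comp := comp
  id_comp := id_comp'
  comp_id := comp_id'
  assoc := assoc'

instance (X Y : Perm₀ μ) : AddCommGroup (X ⟶ Y) :=
  inferInstanceAs (AddCommGroup (Amalg X.obj Y.obj →₀ k))

instance (X Y : Perm₀ μ) : Module k (X ⟶ Y) :=
  inferInstanceAs (Module k (Amalg X.obj Y.obj →₀ k))

/-- The basis morphism `φ_Z : Vec_X → Vec_Y` attached to an amalgamation `Z` of `X` and `Y`. -/
def basisHom {X Y : 𝔉.Obj} (Z : Amalgamation X Y) : (⟨X⟩ : Perm₀ μ) ⟶ ⟨Y⟩ :=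
  (Finsupp.single Z.cls 1 : Amalg X Y →₀ k)

/-- The coefficient of a morphism at a class of amalgamations. -/
def ev {X Y : Perm₀ μ} (f : X ⟶ Y) (W : 𝔉.Obj) (x : Emb X.obj W) (y : Emb Y.obj W) : k :=
  val f W x y

theorem ev_ext {X Y : Perm₀ μ} {f g : X ⟶ Y} (h : ∀ W x y, ev f W x y = ev g W x y) :
    f = g := val_ext h

theorem ev_natural {X Y : Perm₀ μ} (f : X ⟶ Y) : Natural₂ (ev f) := val_natural f

theorem ev_comp {X Y Z : Perm₀ μ} (f : X ⟶ Y) (g : Y ⟶ Z) (W : 𝔉.Obj)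
    (x : Emb X.obj W) (z : Emb Z.obj W) :
    ev (f ≫ g) W x z = μ.integ W Y.obj
      (fun V i y => ev f V (i.comp x) y * ev g V y (i.comp z)) := val_comp f g W x z

theorem ev_id (X : Perm₀ μ) (W : 𝔉.Obj) (x y : Emb X.obj W) [Decidable (x = y)] :
    ev (𝟙 X) W x y = if x = y then 1 else 0 := val_id X W x y

theorem ev_add {X Y : Perm₀ μ} (f g : X ⟶ Y) (W : 𝔉.Obj) (x : Emb X.obj W) (y : Emb Y.obj W) :
    ev (f + g) W x y = ev f W x y + ev g W x y := rfl

theorem ev_zero {X Y : Perm₀ μ} (W : 𝔉.Obj) (x : Emb X.obj W) (y : Emb Y.obj W) :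
    ev (0 : X ⟶ Y) W x y = 0 := rfl

theorem ev_smul {X Y : Perm₀ μ} (c : k) (f : X ⟶ Y) (W : 𝔉.Obj) (x : Emb X.obj W)
    (y : Emb Y.obj W) : ev (c • f) W x y = c * ev f W x y := rfl

theorem ev_sum {X Y : Perm₀ μ} {ι : Type*} (s : Finset ι) (f : ι → (X ⟶ Y)) (W : 𝔉.Obj)
    (x : Emb X.obj W) (y : Emb Y.obj W) : ev (∑ i ∈ s, f i) W x y = ∑ i ∈ s, ev (f i) W x y := by
  classical
  induction s using Finset.induction_on with
  | empty => simp [ev_zero]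
  | insert a s ha ih => rw [Finset.sum_insert ha, Finset.sum_insert ha, ev_add, ih]

/-- The morphism with prescribed values. -/
def ofFun {X Y : Perm₀ μ} (F : ∀ W : 𝔉.Obj, Emb X.obj W → Emb Y.obj W → k) : X ⟶ Y :=
  (Finsupp.equivFunOnFinite.symm fun q => F q.pt q.inl q.inr : Amalg X.obj Y.obj →₀ k)

theorem ev_ofFun {X Y : Perm₀ μ} {F : ∀ W : 𝔉.Obj, Emb X.obj W → Emb Y.obj W → k}
    (hF : Natural₂ F) (W : 𝔉.Obj) (x : Emb X.obj W) (y : Emb Y.obj W) :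
    ev (ofFun F) W x y = F W x y := by
  obtain ⟨e, h1, h2⟩ := exists_lift x y
  have h3 := hF _ _ e (cls x y).inl (cls x y).inr
  rw [h1, h2] at h3
  exact h3.symm

instance : Preadditive (Perm₀ μ) where
  add_comp X Y Z f f' g := ev_ext fun W x z => by
    simp only [ev_comp, ev_add]
    unfold Measure.integ
    rw [← Finset.sum_add_distrib]
    exact Finset.sum_congr rfl fun q _ => by ring
  comp_add X Y Z f g g' := ev_ext fun W x z => by
    simp only [ev_comp, ev_add]
    unfold Measure.integ
    rw [← Finset.sum_add_distrib]
    exact Finset.sum_congr rfl fun q _ => by ring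

instance : Linear k (Perm₀ μ) where
  smul_comp X Y Z c f g := ev_ext fun W x z => by
    simp only [ev_comp, ev_smul]
    rw [← μ.integ_mul]
    exact μ.integ_congr fun V i y => by ring
  comp_smul X Y Z f c g := ev_ext fun W x z => by
    simp only [ev_comp, ev_smul]
    rw [← μ.integ_mul]
    exact μ.integ_congr fun V i y => by ring

end Perm₀

/-- The category `Perm_k(𝔉; μ)`: the additive envelope of `Perm⁰`, that is, the category of finite
families of objects of `Perm⁰` and matrices of morphisms between them. -/
abbrev Perm (μ : Measure 𝔉 k) : Type _ := Mat_ (Perm₀ μ)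

namespace Perm

variable {μ : Measure 𝔉 k}

instance (M N : Perm μ) : Module k (M ⟶ N) :=
  inferInstanceAs (Module k (∀ (i : M.ι) (j : N.ι), M.X i ⟶ N.X j))

theorem smul_apply {M N : Perm μ} (c : k) (A : M ⟶ N) (i : M.ι) (j : N.ι) :
    (c • A) i j = c • A i j := rfl

instance : Linear k (Perm μ) where
  smul_comp M N K c A B := by
    ext i j
    simp only [Mat_.comp_apply, smul_apply, Linear.smul_comp, Finset.smul_sum]
  comp_smul M N K A c B := by
    ext i j
    simp only [Mat_.comp_apply, smul_apply, Linear.comp_smul, Finset.smul_sum]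

/-- The points of a family `M` of structures over `W`: pairs of a member of the family and an
embedding of it into `W`. (If `W` is replaced by the Fraïssé limit `Ω`, this is the set with an
action of `Aut(Ω)` that corresponds to `M`, and morphisms are the invariant matrices whose rows and
columns are indexed by such sets.) -/
structure Pt (M : Perm μ) (W : 𝔉.Obj) where
  idx : M.ι
  emb : Emb (M.X idx).obj W

/-- Functoriality of points. -/
def Pt.push {M : Perm μ} {W V : 𝔉.Obj} (f : Emb W V) (p : Pt M W) : Pt M V := ⟨p.1, f.comp p.2⟩

theorem Pt.push_push {M : Perm μ} {W V U : 𝔉.Obj} (f : Emb W V) (g : Emb V U) (p : Pt M W) :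
    Pt.push g (Pt.push f p) = Pt.push (g.comp f) p := rfl

theorem Pt.push_refl {M : Perm μ} {W : 𝔉.Obj} (p : Pt M W) :
    Pt.push (FirstOrder.Language.Embedding.refl L W.1 : Emb W W) p = p := rfl

theorem Pt.push_injective {M : Perm μ} {W V : 𝔉.Obj} (f : Emb W V) {p q : Pt M W}
    (h : Pt.push f p = Pt.push f q) : p = q := by
  obtain ⟨i, x⟩ := p
  obtain ⟨j, y⟩ := q
  obtain rfl : i = j := congrArg Pt.idx h
  have h' : f.comp x = f.comp y := by
    simpa only [Pt.push, Pt.mk.injEq, heq_eq_eq, true_and] using h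
  rw [Emb.cancel f h']

/-- The value of a morphism on a pair of points: a morphism is viewed as an invariant matrix with
rows and columns indexed by points. -/
def ev {M N : Perm μ} (A : M ⟶ N) (W : 𝔉.Obj) (p : Pt M W) (q : Pt N W) : k :=
  Perm₀.ev (A p.1 q.1) W p.2 q.2

/-- Compatibility of a function of two points with all embeddings. -/
def Natural {M N : Perm μ} (F : ∀ V : 𝔉.Obj, Pt M V → Pt N V → k) : Prop :=
  ∀ (V V' : 𝔉.Obj) (e : Emb V V') p q, F V' (p.push e) (q.push e) = F V p q

/-- The morphism with prescribed values. -/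
def ofFun {M N : Perm μ} (F : ∀ W : 𝔉.Obj, Pt M W → Pt N W → k) : M ⟶ N :=
  fun i j => Perm₀.ofFun fun W x y => F W ⟨i, x⟩ ⟨j, y⟩

theorem ev_ofFun {M N : Perm μ} {F : ∀ W : 𝔉.Obj, Pt M W → Pt N W → k} (hF : Natural F)
    (W : 𝔉.Obj) (p : Pt M W) (q : Pt N W) : ev (ofFun F) W p q = F W p q :=
  Perm₀.ev_ofFun (X := M.X p.1) (Y := N.X q.1) (F := fun W x y => F W ⟨p.1, x⟩ ⟨q.1, y⟩)
    (fun V V' e a b => hF V V' e ⟨p.1, a⟩ ⟨q.1, b⟩) W p.2 q.2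

theorem ev_ext {M N : Perm μ} {A B : M ⟶ N} (h : ∀ W p q, ev A W p q = ev B W p q) : A = B := by
  ext i j
  exact Perm₀.ev_ext fun W x y => h W ⟨i, x⟩ ⟨j, y⟩

theorem ev_natural {M N : Perm μ} (A : M ⟶ N) : Natural (ev A) :=
  fun V V' e p q => Perm₀.ev_natural (A p.1 q.1) V V' e p.2 q.2

theorem ev_add {M N : Perm μ} (A B : M ⟶ N) (W : 𝔉.Obj) (p : Pt M W) (q : Pt N W) :
    ev (A + B) W p q = ev A W p q + ev B W p q := rfl

theorem ev_zero {M N : Perm μ} (W : 𝔉.Obj) (p : Pt M W) (q : Pt N W) :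
    ev (0 : M ⟶ N) W p q = 0 := rfl

theorem ev_smul {M N : Perm μ} (c : k) (A : M ⟶ N) (W : 𝔉.Obj) (p : Pt M W) (q : Pt N W) :
    ev (c • A) W p q = c * ev A W p q := rfl

open Classical in
/-- The Kronecker delta. -/
def kron {α : Type*} (a b : α) : k := if a = b then 1 else 0

theorem kron_self {α : Type*} (a : α) : (kron a a : k) = 1 := if_pos rfl

theorem kron_ne {α : Type*} {a b : α} (h : a ≠ b) : (kron a b : k) = 0 := if_neg h

theorem kron_congr {α β : Type*} {a b : α} {c d : β} (h : a = b ↔ c = d) :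
    (kron a b : k) = kron c d := by
  by_cases hab : a = b
  · have hcd := h.1 hab
    subst hab hcd
    rw [kron_self, kron_self]
  · rw [kron_ne hab, kron_ne fun hc => hab (h.2 hc)]

theorem ev_id (M : Perm μ) (W : 𝔉.Obj) (p q : Pt M W) : ev (𝟙 M) W p q = kron p q := by
  classical
  obtain ⟨i, x⟩ := p
  obtain ⟨j, y⟩ := q
  by_cases h : i = j
  · subst h
    change Perm₀.ev ((𝟙 M : M ⟶ M) i i) W x y = _
    have h1 : (𝟙 M : M ⟶ M) i i = 𝟙 (M.X i) := Mat_.id_apply_self M i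
    rw [h1, Perm₀.ev_id]
    by_cases hxy : x = y
    · subst hxy
      rw [if_pos rfl, kron_self]
    · rw [if_neg hxy, kron_ne]
      intro hc
      apply hxy
      simpa only [Pt.mk.injEq, heq_eq_eq, true_and] using hc
  · change Perm₀.ev ((𝟙 M : M ⟶ M) i j) W x y = _
    have h1 : (𝟙 M : M ⟶ M) i j = 0 := Mat_.id_apply_of_ne M i j h
    rw [h1, Perm₀.ev_zero, kron_ne]
    intro hc
    exact h (congrArg Pt.idx hc)

/-- Integration over the points of `N`, relative to `W`. -/
def integ (W : 𝔉.Obj) (N : Perm μ) (φ : ∀ V : 𝔉.Obj, Emb W V → Pt N V → k) : k :=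
  ∑ j : N.ι, μ.integ W (N.X j).obj fun V f y => φ V f ⟨j, y⟩

theorem ev_comp {M N K : Perm μ} (A : M ⟶ N) (B : N ⟶ K) (W : 𝔉.Obj) (p : Pt M W) (r : Pt K W) :
    ev (A ≫ B) W p r =
      integ W N (fun V f q => ev A V (p.push f) q * ev B V q (r.push f)) := by
  have h : (A ≫ B) p.1 r.1 = ∑ j : N.ι, A p.1 j ≫ B j r.1 := Mat_.comp_apply A B p.1 r.1
  unfold ev integ
  rw [h, Perm₀.ev_sum]
  refine Finset.sum_congr rfl fun j _ => ?_
  rw [Perm₀.ev_comp]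
  rfl

/-- Compatibility of a relative function on points with all embeddings. -/
def RelNatural {W : 𝔉.Obj} {N : Perm μ} (φ : ∀ V : 𝔉.Obj, Emb W V → Pt N V → k) : Prop :=
  ∀ (V V' : 𝔉.Obj) (e : Emb V V') f q, φ V' (e.comp f) (q.push e) = φ V f q

theorem integ_congr {W : 𝔉.Obj} {N : Perm μ} {φ ψ : ∀ V : 𝔉.Obj, Emb W V → Pt N V → k}
    (h : ∀ V f q, φ V f q = ψ V f q) : integ W N φ = integ W N ψ := by
  have : φ = ψ := by
    funext V f q
    exact h V f q
  rw [this]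

theorem integ_mul {W : 𝔉.Obj} {N : Perm μ} (c : k) (φ : ∀ V : 𝔉.Obj, Emb W V → Pt N V → k) :
    integ W N (fun V f q => c * φ V f q) = c * integ W N φ := by
  unfold integ
  rw [Finset.mul_sum]
  exact Finset.sum_congr rfl fun j _ => μ.integ_mul c _

theorem integ_delta {W : 𝔉.Obj} {N : Perm μ} {φ : ∀ V : 𝔉.Obj, Emb W V → Pt N V → k}
    (hφ : RelNatural φ) (q₀ : Pt N W) (h : ∀ V f q, q ≠ q₀.push f → φ V f q = 0) :
    integ W N φ = φ W (FirstOrder.Language.Embedding.refl L W.1) q₀ := by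
  unfold integ
  rw [Finset.sum_eq_single q₀.1]
  · refine μ.integ_delta (φ := fun V f y => φ V f ⟨q₀.1, y⟩)
      (fun V V' e f y => hφ V V' e f ⟨q₀.1, y⟩) q₀.2 ?_
    intro V f y hy
    refine h V f _ ?_
    intro hc
    apply hy
    simpa only [Pt.push, Pt.mk.injEq, heq_eq_eq, true_and] using hc
  · intro j _ hj
    refine μ.integ_delta_zero fun V f y => h V f _ ?_
    intro hc
    exact hj (congrArg Pt.idx hc)
  · intro hc
    exact absurd (Finset.mem_univ _) hc

/-! ### Morphisms from natural bijections of points -/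

/-- A natural bijection between the points of two families. -/
structure PtIso (M N : Perm μ) where
  equiv : ∀ W : 𝔉.Obj, Pt M W ≃ Pt N W
  nat : ∀ {W V : 𝔉.Obj} (f : Emb W V) (p : Pt M W), equiv V (p.push f) = (equiv W p).push f

theorem PtIso.symm_nat {M N : Perm μ} (e : PtIso M N) {W V : 𝔉.Obj} (f : Emb W V) (q : Pt N W) :
    (e.equiv V).symm (q.push f) = ((e.equiv W).symm q).push f := by
  rw [Equiv.symm_apply_eq, e.nat, Equiv.apply_symm_apply]

/-- The inverse natural bijection. -/
def PtIso.symm {M N : Perm μ} (e : PtIso M N) : PtIso N M where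
  equiv W := (e.equiv W).symm
  nat := e.symm_nat

/-- The permutation matrix of a natural bijection. -/
def PtIso.mor {M N : Perm μ} (e : PtIso M N) : M ⟶ N :=
  ofFun fun W p q => kron (e.equiv W p) q

theorem PtIso.ev_mor {M N : Perm μ} (e : PtIso M N) (W : 𝔉.Obj) (p : Pt M W) (q : Pt N W) :
    ev e.mor W p q = kron (e.equiv W p) q := by
  refine ev_ofFun ?_ W p q
  intro V V' f p q
  beta_reduce
  rw [e.nat]
  exact kron_congr ⟨Pt.push_injective f, fun h => by rw [h]⟩

theorem comp_relNatural {M N K : Perm μ} (A : M ⟶ N) (B : N ⟶ K) {W : 𝔉.Obj} (p : Pt M W)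
    (r : Pt K W) : RelNatural (fun (V : 𝔉.Obj) (f : Emb W V) (q : Pt N V) =>
      ev A V (p.push f) q * ev B V q (r.push f)) := by
  intro V V' e f q
  beta_reduce
  rw [← ev_natural A V V' e, ← ev_natural B V V' e]
  rfl

theorem PtIso.ev_mor_comp {M N K : Perm μ} (e : PtIso M N) (B : N ⟶ K) (W : 𝔉.Obj) (p : Pt M W)
    (r : Pt K W) : ev (e.mor ≫ B) W p r = ev B W (e.equiv W p) r := by
  rw [ev_comp, integ_delta (comp_relNatural _ _ p r) (e.equiv W p)]
  · rw [e.ev_mor, Pt.push_refl, kron_self, one_mul, Pt.push_refl]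
  · intro V f q hq
    rw [e.ev_mor, e.nat, kron_ne (Ne.symm hq), zero_mul]

theorem PtIso.ev_comp_mor {M N K : Perm μ} (A : M ⟶ N) (e : PtIso N K) (W : 𝔉.Obj) (p : Pt M W)
    (r : Pt K W) : ev (A ≫ e.mor) W p r = ev A W p ((e.equiv W).symm r) := by
  rw [ev_comp, integ_delta (comp_relNatural _ _ p r) ((e.equiv W).symm r)]
  · rw [e.ev_mor, Pt.push_refl, Pt.push_refl, Equiv.apply_symm_apply, kron_self, mul_one]
  · intro V f q hq
    rw [e.ev_mor, kron_ne, mul_zero]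
    intro hc
    apply hq
    rw [← e.symm_nat, ← hc, Equiv.symm_apply_apply]

/-- The isomorphism given by a natural bijection of points. -/
def PtIso.iso {M N : Perm μ} (e : PtIso M N) : M ≅ N where
  hom := e.mor
  inv := e.symm.mor
  hom_inv_id := ev_ext fun W p q => by
    rw [e.ev_mor_comp, e.symm.ev_mor, ev_id]
    change kron ((e.equiv W).symm (e.equiv W p)) q = _
    rw [Equiv.symm_apply_apply]
  inv_hom_id := ev_ext fun W p q => by
    rw [e.symm.ev_mor_comp, e.ev_mor, ev_id]
    change kron (e.equiv W ((e.equiv W).symm p)) q = _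
    rw [Equiv.apply_symm_apply]

/-! ### The tensor product -/

/-- The tensor product, extending `Vec_X ⊗ Vec_Y = ⨁_{Z ∈ Amalg(X, Y)} Vec_Z` biadditively.
(The index set is finite, and `Shrink` moves it to the lowest universe.) -/
def tensor (M N : Perm μ) : Perm μ where
  ι := Shrink.{0} (Σ p : M.ι × N.ι, Amalg (M.X p.1).obj (N.X p.2).obj)
  fintype := Fintype.ofEquiv _ (equivShrink _)
  X := fun s => ⟨((equivShrink _).symm s).2.pt⟩

theorem sum_tensor {M N : Perm μ} (F : ∀ i j, Amalg (M.X i).obj (N.X j).obj → k) :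
    ∑ s : (tensor M N).ι, F ((equivShrink _).symm s).1.1 ((equivShrink _).symm s).1.2
      ((equivShrink _).symm s).2 = ∑ i : M.ι, ∑ j : N.ι, ∑ q, F i j q := by
  rw [← Fintype.sum_prod_type' (fun i j => ∑ q, F i j q),
    ← Fintype.sum_sigma' (fun (p : M.ι × N.ι) q => F p.1 p.2 q)]
  exact Fintype.sum_equiv (equivShrink _).symm _ _ fun s => rfl

/-- The first projection from the points of a tensor product. -/
def fst {M N : Perm μ} {W : 𝔉.Obj} (t : Pt (tensor M N) W) : Pt M W :=
  ⟨((equivShrink _).symm t.1).1.1, Language.Embedding.comp t.2 ((equivShrink _).symm t.1).2.inl⟩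

/-- The second projection from the points of a tensor product. -/
def snd {M N : Perm μ} {W : 𝔉.Obj} (t : Pt (tensor M N) W) : Pt N W :=
  ⟨((equivShrink _).symm t.1).1.2, Language.Embedding.comp t.2 ((equivShrink _).symm t.1).2.inr⟩

theorem fst_push {M N : Perm μ} {W V : 𝔉.Obj} (f : Emb W V) (t : Pt (tensor M N) W) :
    fst (t.push f) = (fst t).push f := rfl

theorem snd_push {M N : Perm μ} {W V : 𝔉.Obj} (f : Emb W V) (t : Pt (tensor M N) W) :
    snd (t.push f) = (snd t).push f := rfl

theorem pair_bijective (M N : Perm μ) (W : 𝔉.Obj) :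
    Function.Bijective (fun t : Pt (tensor M N) W => (fst t, snd t)) := by
  constructor
  · have key : ∀ (u u' : Σ p : M.ι × N.ι, Amalg (M.X p.1).obj (N.X p.2).obj)
        (z : Emb u.2.pt W) (z' : Emb u'.2.pt W),
        (⟨u.1.1, Language.Embedding.comp z u.2.inl⟩ : Pt M W) =
          ⟨u'.1.1, Language.Embedding.comp z' u'.2.inl⟩ →
        (⟨u.1.2, Language.Embedding.comp z u.2.inr⟩ : Pt N W) =
          ⟨u'.1.2, Language.Embedding.comp z' u'.2.inr⟩ → u = u' ∧ z ≍ z' := by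
      rintro ⟨⟨i, j⟩, q⟩ ⟨⟨i', j'⟩, q'⟩ z z' h1 h2
      obtain rfl : i = i' := congrArg Pt.idx h1
      obtain rfl : j = j' := congrArg Pt.idx h2
      simp only [Pt.mk.injEq, heq_eq_eq, true_and] at h1 h2
      have hq : q = q' := by
        rw [← cls_rep q, ← cls_rep q', ← cls_comp z, ← cls_comp z' q'.inl, h1, h2]
      subst hq
      exact ⟨rfl, heq_of_eq (q.rep.surj.hom_ext h1 h2)⟩
    rintro ⟨s, z⟩ ⟨s', z'⟩ h
    obtain ⟨h1, h2⟩ := key ((equivShrink _).symm s) ((equivShrink _).symm s') z z'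
      (congrArg Prod.fst h) (congrArg Prod.snd h)
    obtain rfl : s = s' := (equivShrink _).symm.injective h1
    obtain rfl := eq_of_heq h2
    rfl
  · rintro ⟨⟨i, x⟩, ⟨j, y⟩⟩
    obtain ⟨e, h1, h2⟩ := exists_lift x y
    have key : ∀ (s : (tensor M N).ι) (u : Σ p : M.ι × N.ι, Amalg (M.X p.1).obj (N.X p.2).obj)
        (_ : (equivShrink _).symm s = u) (e : Emb u.2.pt W), ∃ t : Pt (tensor M N) W,
        fst t = ⟨u.1.1, Language.Embedding.comp e u.2.inl⟩ ∧
        snd t = ⟨u.1.2, Language.Embedding.comp e u.2.inr⟩ := by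
      rintro s _ rfl e
      exact ⟨⟨s, e⟩, rfl, rfl⟩
    obtain ⟨t, h3, h4⟩ := key (equivShrink _ ⟨(i, j), cls x y⟩) ⟨(i, j), cls x y⟩
      (Equiv.symm_apply_apply _ _) e
    refine ⟨t, Prod.ext ?_ ?_⟩
    · exact h3.trans (congrArg (Pt.mk i) h1)
    · exact h4.trans (congrArg (Pt.mk j) h2)

/-- A point of a tensor product is a pair of points. -/
def pairEquiv (M N : Perm μ) (W : 𝔉.Obj) : Pt (tensor M N) W ≃ Pt M W × Pt N W :=
  Equiv.ofBijective _ (pair_bijective M N W)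

/-- The point of a tensor product with given projections. -/
def pair {M N : Perm μ} {W : 𝔉.Obj} (p : Pt M W) (q : Pt N W) : Pt (tensor M N) W :=
  (pairEquiv M N W).symm (p, q)

theorem fst_snd_pair {M N : Perm μ} {W : 𝔉.Obj} (p : Pt M W) (q : Pt N W) :
    (fst (pair p q), snd (pair p q)) = (p, q) := (pairEquiv M N W).apply_symm_apply (p, q)

@[simp]
theorem fst_pair {M N : Perm μ} {W : 𝔉.Obj} (p : Pt M W) (q : Pt N W) : fst (pair p q) = p :=
  congrArg Prod.fst (fst_snd_pair p q)

@[simp]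
theorem snd_pair {M N : Perm μ} {W : 𝔉.Obj} (p : Pt M W) (q : Pt N W) : snd (pair p q) = q :=
  congrArg Prod.snd (fst_snd_pair p q)

@[simp]
theorem pair_fst_snd {M N : Perm μ} {W : 𝔉.Obj} (t : Pt (tensor M N) W) :
    pair (fst t) (snd t) = t := (pairEquiv M N W).symm_apply_apply t

theorem pt_ext {M N : Perm μ} {W : 𝔉.Obj} {t t' : Pt (tensor M N) W} (h1 : fst t = fst t')
    (h2 : snd t = snd t') : t = t' := (pair_bijective M N W).1 (Prod.ext h1 h2)

theorem pair_push {M N : Perm μ} {W V : 𝔉.Obj} (f : Emb W V) (p : Pt M W) (q : Pt N W) :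
    (pair p q).push f = pair (p.push f) (q.push f) := by
  apply pt_ext
  · rw [fst_push, fst_pair, fst_pair]
  · rw [snd_push, snd_pair, snd_pair]

theorem pair_inj {M N : Perm μ} {W : 𝔉.Obj} {p p' : Pt M W} {q q' : Pt N W} :
    pair p q = pair p' q' ↔ p = p' ∧ q = q' := by
  unfold pair
  rw [Equiv.apply_eq_iff_eq, Prod.mk.injEq]

theorem kron_pair {M N : Perm μ} {W : 𝔉.Obj} (t t' : Pt (tensor M N) W) :
    (kron t t' : k) = kron (fst t) (fst t') * kron (snd t) (snd t') := by
  by_cases h1 : fst t = fst t'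
  · by_cases h2 : snd t = snd t'
    · rw [pt_ext h1 h2, kron_self, kron_self, kron_self, one_mul]
    · rw [kron_ne h2, mul_zero, kron_ne]
      rintro rfl
      exact h2 rfl
  · rw [kron_ne h1, zero_mul, kron_ne]
    rintro rfl
    exact h1 rfl

theorem integ_tensor {W : 𝔉.Obj} {M N : Perm μ}
    (ψ : ∀ V : 𝔉.Obj, Emb W V → Pt M V → Pt N V → k)
    (hψ : ∀ (V V' : 𝔉.Obj) (e : Emb V V') f p q,
      ψ V' (e.comp f) (p.push e) (q.push e) = ψ V f p q) :
    integ W (tensor M N) (fun V f t => ψ V f (fst t) (snd t)) =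
      integ W M (fun V f p => integ V N (fun V' g q => ψ V' (g.comp f) (p.push g) q)) := by
  have h1 : integ W (tensor M N) (fun V f t => ψ V f (fst t) (snd t)) =
      ∑ i : M.ι, ∑ j : N.ι, ∑ q : Amalg (M.X i).obj (N.X j).obj, μ.integ W q.pt (fun V f t =>
        ψ V f ⟨i, Language.Embedding.comp t q.inl⟩ ⟨j, Language.Embedding.comp t q.inr⟩) :=
    sum_tensor (fun i j q => μ.integ W q.pt (fun V f t =>
        ψ V f ⟨i, Language.Embedding.comp t q.inl⟩ ⟨j, Language.Embedding.comp t q.inr⟩))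
  rw [h1]
  unfold integ
  refine Finset.sum_congr rfl fun i _ => ?_
  rw [μ.integ_sum]
  refine Finset.sum_congr rfl fun j _ => ?_
  exact μ.integ_tensor (ψ := fun V f y z => ψ V f ⟨i, y⟩ ⟨j, z⟩)
    (fun V V' e a b c => hψ V V' e a ⟨i, b⟩ ⟨j, c⟩)

/-- The tensor product of morphisms: the Kronecker product of matrices, where the points of a tensor
product are identified with the pairs of points. -/
def tensorMor {M N M' N' : Perm μ} (A : M ⟶ M') (B : N ⟶ N') : tensor M N ⟶ tensor M' N' :=
  ofFun fun W t t' => ev A W (fst t) (fst t') * ev B W (snd t) (snd t')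

theorem ev_tensorMor {M N M' N' : Perm μ} (A : M ⟶ M') (B : N ⟶ N') (W : 𝔉.Obj)
    (t : Pt (tensor M N) W) (t' : Pt (tensor M' N') W) :
    ev (tensorMor A B) W t t' = ev A W (fst t) (fst t') * ev B W (snd t) (snd t') := by
  refine ev_ofFun ?_ W t t'
  intro V V' e p q
  beta_reduce
  rw [fst_push, fst_push, snd_push, snd_push, ev_natural A V V' e, ev_natural B V V' e]

theorem tensorMor_id (M N : Perm μ) : tensorMor (𝟙 M) (𝟙 N) = 𝟙 (tensor M N) :=
  ev_ext fun W t t' => by rw [ev_tensorMor, ev_id, ev_id, ev_id, kron_pair]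

/-- The integrand in the composition of two Kronecker products. -/
def compFun {M N M' N' M'' N'' : Perm μ} (A : M ⟶ M') (B : N ⟶ N') (A' : M' ⟶ M'')
    (B' : N' ⟶ N'') {W : 𝔉.Obj} (t : Pt (tensor M N) W) (r : Pt (tensor M'' N'') W)
    (V : 𝔉.Obj) (f : Emb W V) (p : Pt M' V) (q : Pt N' V) : k :=
  (ev A V ((fst t).push f) p * ev A' V p ((fst r).push f)) *
    (ev B V ((snd t).push f) q * ev B' V q ((snd r).push f))

theorem compFun_natural {M N M' N' M'' N'' : Perm μ} (A : M ⟶ M') (B : N ⟶ N') (A' : M' ⟶ M'')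
    (B' : N' ⟶ N'') {W : 𝔉.Obj} (t : Pt (tensor M N) W) (r : Pt (tensor M'' N'') W)
    (V V' : 𝔉.Obj) (e : Emb V V') (f : Emb W V) (p : Pt M' V) (q : Pt N' V) :
    compFun A B A' B' t r V' (e.comp f) (p.push e) (q.push e) = compFun A B A' B' t r V f p q := by
  unfold compFun
  simp only [← Pt.push_push]
  rw [ev_natural A V V' e, ev_natural A' V V' e, ev_natural B V V' e, ev_natural B' V V' e]

theorem tensorMor_comp {M N M' N' M'' N'' : Perm μ} (A : M ⟶ M') (B : N ⟶ N') (A' : M' ⟶ M'')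
    (B' : N' ⟶ N'') : tensorMor A B ≫ tensorMor A' B' = tensorMor (A ≫ A') (B ≫ B') := by
  refine ev_ext fun W t r => ?_
  have h1 : ev (tensorMor A B ≫ tensorMor A' B') W t r =
      integ W (tensor M' N') (fun V f s => compFun A B A' B' t r V f (fst s) (snd s)) := by
    rw [ev_comp]
    refine integ_congr fun V f s => ?_
    rw [ev_tensorMor, ev_tensorMor]
    unfold compFun
    simp only [fst_push, snd_push]
    ring
  have h2 := integ_tensor (compFun A B A' B' t r) (compFun_natural A B A' B' t r)
  have h3 : integ W M' (fun V f p => integ V N' (fun V' g q =>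
      compFun A B A' B' t r V' (g.comp f) (p.push g) q)) =
      ev (tensorMor (A ≫ A') (B ≫ B')) W t r := by
    rw [ev_tensorMor, ev_comp A A', mul_comm, ← integ_mul]
    refine integ_congr fun V f p => ?_
    rw [mul_comm, ← ev_natural (B ≫ B') W V f, ev_comp, ← integ_mul]
    refine integ_congr fun V' g q => ?_
    unfold compFun
    simp only [← Pt.push_push]
    rw [ev_natural A V V' g, ev_natural A' V V' g]
  exact h1.trans (h2.trans h3)

theorem PtIso.mor_ext {M N : Perm μ} {e f : PtIso M N}
    (h : ∀ (W : 𝔉.Obj) (p : Pt M W), e.equiv W p = f.equiv W p) : e.mor = f.mor :=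
  ev_ext fun W p q => by rw [e.ev_mor, f.ev_mor, h]

/-- The identity bijection. -/
def PtIso.refl (M : Perm μ) : PtIso M M where
  equiv W := Equiv.refl _
  nat := fun _ _ => rfl

/-- Composition of natural bijections. -/
def PtIso.trans {M N K : Perm μ} (e : PtIso M N) (f : PtIso N K) : PtIso M K where
  equiv W := (e.equiv W).trans (f.equiv W)
  nat := fun g p => by
    simp only [Equiv.trans_apply]
    rw [e.nat, f.nat]

/-- Tensor product of natural bijections. -/
def PtIso.tensor {M N M' N' : Perm μ} (e : PtIso M M') (f : PtIso N N') :
    PtIso (Perm.tensor M N) (Perm.tensor M' N') where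
  equiv W :=
    { toFun := fun t => pair (e.equiv W (fst t)) (f.equiv W (snd t))
      invFun := fun t => pair ((e.equiv W).symm (fst t)) ((f.equiv W).symm (snd t))
      left_inv := fun t => by simp
      right_inv := fun t => by simp }
  nat := fun g t => by
    simp only [Equiv.coe_fn_mk]
    rw [fst_push, snd_push, e.nat, f.nat, pair_push]

theorem PtIso.refl_mor (M : Perm μ) : (PtIso.refl M).mor = 𝟙 M :=
  ev_ext fun W p q => by rw [PtIso.ev_mor, ev_id]; rfl

theorem PtIso.mor_comp_mor {M N K : Perm μ} (e : PtIso M N) (f : PtIso N K) :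
    e.mor ≫ f.mor = (e.trans f).mor :=
  ev_ext fun W p q => by rw [e.ev_mor_comp, PtIso.ev_mor, PtIso.ev_mor]; rfl

theorem PtIso.tensorMor_mor {M N M' N' : Perm μ} (e : PtIso M M') (f : PtIso N N') :
    tensorMor e.mor f.mor = (e.tensor f).mor :=
  ev_ext fun W t t' => by
    rw [ev_tensorMor, PtIso.ev_mor, PtIso.ev_mor, PtIso.ev_mor, kron_pair]
    simp [PtIso.tensor]

/-- The associativity bijection. -/
def assocIso (M N K : Perm μ) : PtIso (tensor (tensor M N) K) (tensor M (tensor N K)) where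
  equiv W :=
    { toFun := fun t => pair (fst (fst t)) (pair (snd (fst t)) (snd t))
      invFun := fun t => pair (pair (fst t) (fst (snd t))) (snd (snd t))
      left_inv := fun t => by simp
      right_inv := fun t => by simp }
  nat := fun g t => by simp only [Equiv.coe_fn_mk, fst_push, snd_push, pair_push]

/-- The symmetry bijection. -/
def braidIso (M N : Perm μ) : PtIso (tensor M N) (tensor N M) where
  equiv W :=
    { toFun := fun t => pair (snd t) (fst t)
      invFun := fun t => pair (snd t) (fst t)
      left_inv := fun t => by simp
      right_inv := fun t => by simp }
  nat := fun g t => by simp only [Equiv.coe_fn_mk, fst_push, snd_push, pair_push]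

end Perm

variable [IsEmpty (L.Relations 0)]

/-- The empty structure. -/
def emptyStr (L : FirstOrder.Language.{u, v}) [L.IsRelational] : Bundled.{w} L.Structure :=
  ⟨PEmpty, { funMap := fun f => isEmptyElim f, RelMap := fun _ _ => False }⟩

/-- The embedding of the empty structure into a structure; there are no relations of arity `0`. -/
def emptyEmb (X : Bundled.{w} L.Structure) : emptyStr.{u, v, w} L ↪[L] X where
  toFun := fun a => PEmpty.elim a
  inj' := fun a => PEmpty.elim a
  map_fun' := fun f => isEmptyElim f
  map_rel' := fun {n} R x => by
    cases n with
    | zero => exact isEmptyElim R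
    | succ n => exact PEmpty.elim (x 0)

/-- The empty structure, as a member of a Fraïssé class. -/
def emptyObj (𝔉 : FraisseClass.{u, v, w} L) : 𝔉.Obj :=
  ⟨emptyStr L, 𝔉.hereditary _ 𝔉.nonempty.some_mem _ ⟨emptyEmb _⟩⟩

/-- The embedding of the empty structure into a member of the class. -/
def fromEmpty (X : 𝔉.Obj) : Emb (emptyObj 𝔉) X := emptyEmb X.1

theorem emb_empty_eq {X : 𝔉.Obj} (f g : Emb (emptyObj 𝔉) X) : f = g := by
  ext a
  exact PEmpty.elim a

namespace Perm

variable {μ : Measure 𝔉 k}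

/-- The unit object: the object `Vec_∅` attached to the empty structure. -/
def unit (μ : Measure 𝔉 k) : Perm μ := (Mat_.embedding (Perm₀ μ)).obj ⟨emptyObj 𝔉⟩

/-- The unique point of the unit object. -/
def star (W : 𝔉.Obj) : Pt (unit μ) W := ⟨PUnit.unit, fromEmpty W⟩

theorem eq_star {W : 𝔉.Obj} (p : Pt (unit μ) W) : p = star W := by
  obtain ⟨⟨⟩, x⟩ := p
  have hx : x = fromEmpty W := emb_empty_eq _ _
  rw [hx]
  rfl

/-- The left unit bijection. -/
def leftIso (M : Perm μ) : PtIso (tensor (unit μ) M) M where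
  equiv W :=
    { toFun := fun t => snd t
      invFun := fun p => pair (star W) p
      left_inv := fun t => by
        change pair (star W) (snd t) = t
        rw [← eq_star (fst t), pair_fst_snd]
      right_inv := fun p => by simp }
  nat := fun g t => rfl

/-- The right unit bijection. -/
def rightIso (M : Perm μ) : PtIso (tensor M (unit μ)) M where
  equiv W :=
    { toFun := fun t => fst t
      invFun := fun p => pair p (star W)
      left_inv := fun t => by
        change pair (fst t) (star W) = t
        rw [← eq_star (snd t), pair_fst_snd]
      right_inv := fun p => by simp }
  nat := fun g t => rfl

/-- The tensor structure. The structural isomorphisms are the permutation matrices of the evident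
bijections `((x, y), z) ↦ (x, (y, z))`, `(*, x) ↦ x`, `(x, *) ↦ x` on points. -/
instance : MonoidalCategoryStruct (Perm μ) where
  tensorObj := tensor
  whiskerLeft M _ _ B := tensorMor (𝟙 M) B
  whiskerRight A N := tensorMor A (𝟙 N)
  tensorHom := tensorMor
  tensorUnit := unit μ
  associator M N K := (assocIso M N K).iso
  leftUnitor M := (leftIso M).iso
  rightUnitor M := (rightIso M).iso

instance : MonoidalCategory (Perm μ) :=
  MonoidalCategory.ofTensorHom
    (id_tensorHom_id := tensorMor_id)
    (id_tensorHom := fun _ _ _ _ => rfl)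
    (tensorHom_id := fun _ _ => rfl)
    (tensorHom_comp_tensorHom := fun A B A' B' => tensorMor_comp A B A' B')
    (associator_naturality := fun {M₁ M₂ M₃ N₁ N₂ N₃} A B C => by
      change tensorMor (tensorMor A B) C ≫ (assocIso N₁ N₂ N₃).mor =
        (assocIso M₁ M₂ M₃).mor ≫ tensorMor A (tensorMor B C)
      refine ev_ext fun W t t' => ?_
      rw [PtIso.ev_comp_mor, PtIso.ev_mor_comp]
      simp [ev_tensorMor, assocIso, mul_assoc])
    (leftUnitor_naturality := fun {M N} A => by
      change tensorMor (𝟙 (unit μ)) A ≫ (leftIso N).mor = (leftIso M).mor ≫ A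
      refine ev_ext fun W t t' => ?_
      rw [PtIso.ev_comp_mor, PtIso.ev_mor_comp, ev_tensorMor, ev_id, eq_star (fst t),
        eq_star (fst (((leftIso N).equiv W).symm t')), kron_self, one_mul]
      simp [leftIso])
    (rightUnitor_naturality := fun {M N} A => by
      change tensorMor A (𝟙 (unit μ)) ≫ (rightIso N).mor = (rightIso M).mor ≫ A
      refine ev_ext fun W t t' => ?_
      rw [PtIso.ev_comp_mor, PtIso.ev_mor_comp, ev_tensorMor, ev_id, eq_star (snd t),
        eq_star (snd (((rightIso N).equiv W).symm t')), kron_self, mul_one]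
      simp [rightIso])
    (pentagon := fun M N K T => by
      change tensorMor (assocIso M N K).mor (𝟙 T) ≫ (assocIso M (tensor N K) T).mor ≫
        tensorMor (𝟙 M) (assocIso N K T).mor =
        (assocIso (tensor M N) K T).mor ≫ (assocIso M N (tensor K T)).mor
      rw [← PtIso.refl_mor, ← PtIso.refl_mor, PtIso.tensorMor_mor, PtIso.tensorMor_mor,
        PtIso.mor_comp_mor, PtIso.mor_comp_mor, PtIso.mor_comp_mor]
      refine PtIso.mor_ext fun W t => ?_
      simp [PtIso.trans, PtIso.tensor, PtIso.refl, assocIso])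
    (triangle := fun M N => by
      change (assocIso M (unit μ) N).mor ≫ tensorMor (𝟙 M) (leftIso N).mor =
        tensorMor (rightIso M).mor (𝟙 N)
      rw [← PtIso.refl_mor, ← PtIso.refl_mor, PtIso.tensorMor_mor, PtIso.tensorMor_mor,
        PtIso.mor_comp_mor]
      refine PtIso.mor_ext fun W t => ?_
      simp [PtIso.trans, PtIso.tensor, PtIso.refl, assocIso, leftIso, rightIso])

/-- The symmetry is the permutation matrix of the bijection `(x, y) ↦ (y, x)` on points. -/
instance : SymmetricCategory (Perm μ) where
  braiding M N := (braidIso M N).iso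
  braiding_naturality_right M {N K} A := by
    change tensorMor (𝟙 M) A ≫ (braidIso M K).mor = (braidIso M N).mor ≫ tensorMor A (𝟙 M)
    refine ev_ext fun W t t' => ?_
    rw [PtIso.ev_comp_mor, PtIso.ev_mor_comp]
    simp [ev_tensorMor, braidIso, mul_comm]
  braiding_naturality_left {M N} A K := by
    change tensorMor A (𝟙 K) ≫ (braidIso N K).mor = (braidIso M K).mor ≫ tensorMor (𝟙 K) A
    refine ev_ext fun W t t' => ?_
    rw [PtIso.ev_comp_mor, PtIso.ev_mor_comp]
    simp [ev_tensorMor, braidIso, mul_comm]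
  hexagon_forward M N K := by
    change (assocIso M N K).mor ≫ (braidIso M (tensor N K)).mor ≫ (assocIso N K M).mor =
      tensorMor (braidIso M N).mor (𝟙 K) ≫ (assocIso N M K).mor ≫
        tensorMor (𝟙 N) (braidIso M K).mor
    rw [← PtIso.refl_mor, ← PtIso.refl_mor, PtIso.tensorMor_mor, PtIso.tensorMor_mor,
      PtIso.mor_comp_mor, PtIso.mor_comp_mor, PtIso.mor_comp_mor, PtIso.mor_comp_mor]
    refine PtIso.mor_ext fun W t => ?_
    simp [PtIso.trans, PtIso.tensor, PtIso.refl, assocIso, braidIso]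
  hexagon_reverse M N K := by
    change (assocIso M N K).symm.mor ≫ (braidIso (tensor M N) K).mor ≫
        (assocIso K M N).symm.mor =
      tensorMor (𝟙 M) (braidIso N K).mor ≫ (assocIso M K N).symm.mor ≫
        tensorMor (braidIso M K).mor (𝟙 N)
    rw [← PtIso.refl_mor, ← PtIso.refl_mor, PtIso.tensorMor_mor, PtIso.tensorMor_mor,
      PtIso.mor_comp_mor, PtIso.mor_comp_mor, PtIso.mor_comp_mor, PtIso.mor_comp_mor]
    refine PtIso.mor_ext fun W t => ?_
    simp [PtIso.trans, PtIso.tensor, PtIso.refl, PtIso.symm, assocIso, braidIso]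
  symmetry M N := by
    change (braidIso M N).mor ≫ (braidIso N M).mor = 𝟙 (tensor M N)
    rw [← PtIso.refl_mor, PtIso.mor_comp_mor]
    refine PtIso.mor_ext fun W t => ?_
    simp [PtIso.trans, PtIso.refl, braidIso]

instance : MonoidalPreadditive (Perm μ) where
  whiskerLeft_zero {M N K} := by
    change tensorMor (𝟙 M) (0 : N ⟶ K) = 0
    exact ev_ext fun W t t' => by rw [ev_tensorMor, ev_zero, ev_zero, mul_zero]
  zero_whiskerRight {M N K} := by
    change tensorMor (0 : N ⟶ K) (𝟙 M) = 0
    exact ev_ext fun W t t' => by rw [ev_tensorMor, ev_zero, ev_zero, zero_mul]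
  whiskerLeft_add {M N K} A B := by
    change tensorMor (𝟙 M) (A + B) = tensorMor (𝟙 M) A + tensorMor (𝟙 M) B
    exact ev_ext fun W t t' => by
      rw [ev_add, ev_tensorMor, ev_tensorMor, ev_tensorMor, ev_add, mul_add]
  add_whiskerRight {M N K} A B := by
    change tensorMor (A + B) (𝟙 M) = tensorMor A (𝟙 M) + tensorMor B (𝟙 M)
    exact ev_ext fun W t t' => by
      rw [ev_add, ev_tensorMor, ev_tensorMor, ev_tensorMor, ev_add, add_mul]

instance : MonoidalLinear k (Perm μ) where
  whiskerLeft_smul M {N K} c A := by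
    change tensorMor (𝟙 M) (c • A) = c • tensorMor (𝟙 M) A
    exact ev_ext fun W t t' => by
      rw [ev_smul, ev_tensorMor, ev_tensorMor, ev_smul, mul_left_comm]
  smul_whiskerRight c {N K} A M := by
    change tensorMor (c • A) (𝟙 M) = c • tensorMor A (𝟙 M)
    exact ev_ext fun W t t' => by
      rw [ev_smul, ev_tensorMor, ev_tensorMor, ev_smul, mul_assoc]

/-- The object `Vec_X` of `Perm_k(𝔉; μ)`. -/
def vec (μ : Measure 𝔉 k) (X : 𝔉.Obj) : Perm μ := (Mat_.embedding (Perm₀ μ)).obj ⟨X⟩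

/-- The morphism `φ_Z : Vec_X → Vec_Y` attached to an amalgamation `Z` of `X` and `Y`. -/
def phi (μ : Measure 𝔉 k) {X Y : 𝔉.Obj} (Z : Amalgamation X Y) : vec μ X ⟶ vec μ Y :=
  (Mat_.embedding (Perm₀ μ)).map (Perm₀.basisHom Z)

end Perm

namespace Measure

variable (μ : Measure 𝔉 k)

/-- The measure `μ(X)` of a structure: the value of `μ` on the embedding of the empty structure. -/
def mass (X : 𝔉.Obj) : k := μ.toFun (fromEmpty X)

theorem exists_cls {X Y : 𝔉.Obj} (A : Amalgamation X Y) : ∃ e : Emb A.cls.pt A.pt,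
    e.comp A.cls.inl = A.inl ∧ e.comp A.cls.inr = A.inr := by
  obtain ⟨e, h1, h2⟩ := Quotient.exact (Quotient.out_eq A.cls)
  exact ⟨e.toEmbedding, h1, h2⟩

theorem mass_mul {X Y : 𝔉.Obj} (i : Emb X Y) : μ.toFun i * μ.mass X = μ.mass Y := by
  unfold mass
  rw [← μ.map_comp, emb_empty_eq (i.comp (fromEmpty X)) (fromEmpty Y)]

variable [IsDomain k]

/-- The subclass `𝔉'` of structures of non-zero measure; it is again a Fraïssé class. -/
def nonzero : FraisseClass.{u, v, w} L where
  carrier := {X | ∃ h : X ∈ 𝔉.carrier, μ.mass ⟨X, h⟩ ≠ 0}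
  nonempty := ⟨emptyStr L, (emptyObj 𝔉).2, by
    change μ.toFun (fromEmpty (emptyObj 𝔉)) ≠ 0
    rw [μ.map_surj _ (fun a => PEmpty.elim a)]
    exact one_ne_zero⟩
  finite := fun X hX => 𝔉.finite X hX.1
  finitely_many := fun n => by
    obtain ⟨S, hS, h⟩ := 𝔉.finitely_many n
    exact ⟨S, hS, fun X hX => h X hX.1⟩
  hereditary := by
    rintro X ⟨hX, h0⟩ Y ⟨e⟩
    have hY := 𝔉.hereditary X hX Y ⟨e⟩
    refine ⟨hY, fun h => h0 ?_⟩
    rw [← μ.mass_mul (X := ⟨Y, hY⟩) (Y := ⟨X, hX⟩) e, h, mul_zero]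
  amalgamation := by
    rintro X ⟨hX, hX0⟩ Y₁ ⟨hY₁, hY₁0⟩ Y₂ ⟨hY₂, hY₂0⟩ i₁ i₂
    have h1 : μ.toFun (X := ⟨X, hX⟩) (Y := ⟨Y₂, hY₂⟩) i₂ ≠ 0 := by
      intro h
      apply hY₂0
      rw [← μ.mass_mul (X := ⟨X, hX⟩) (Y := ⟨Y₂, hY₂⟩) i₂, h, zero_mul]
    rw [μ.map_amalg (X := ⟨X, hX⟩) (Y := ⟨Y₂, hY₂⟩) (X' := ⟨Y₁, hY₁⟩) i₂ i₁] at h1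
    obtain ⟨q, -, hq⟩ := Finset.exists_ne_zero_of_sum_ne_zero h1
    refine ⟨q.1.pt.1, ⟨q.1.pt.2, ?_⟩, q.1.inl, q.1.inr, q.2, ?_⟩
    · change μ.mass q.1.pt ≠ 0
      rw [← μ.mass_mul q.1.inl]
      exact mul_ne_zero hq hY₁0
    · ext z
      simp only [Set.mem_union, Set.mem_range, Set.mem_univ, iff_true]
      exact q.1.rep.surj z

/-- A member of `𝔉'`, regarded as a member of `𝔉`. -/
abbrev incl {μ : Measure 𝔉 k} (X : μ.nonzero.Obj) : 𝔉.Obj := ⟨X.1, X.2.1⟩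

/-- An amalgamation in `𝔉'`, regarded as an amalgamation in `𝔉`. -/
def inclAmalgamation {μ : Measure 𝔉 k} {X Y : μ.nonzero.Obj} (Z : Amalgamation X Y) :
    Amalgamation (incl X) (incl Y) where
  pt := incl Z.pt
  inl := Z.inl
  inr := Z.inr
  surj := Z.surj

/-- The restriction `μ'` of the measure `μ` to the class `𝔉'`. -/
def restrict : Measure μ.nonzero k where
  toFun := fun {X Y} i => μ.toFun (X := incl X) (Y := incl Y) i
  map_equiv := fun {X Y} e => μ.map_equiv (X := incl X) (Y := incl Y) e
  map_comp := fun {X Y Z} i j => μ.map_comp (X := incl X) (Y := incl Y) (Z := incl Z) i j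
  map_amalg := fun {X Y X'} i j => by
    rw [μ.map_amalg (X := incl X) (Y := incl Y) (X' := incl X') i j]
    symm
    refine Finset.sum_of_injOn (fun q => ⟨(inclAmalgamation q.1.rep).cls, ?_⟩) ?_ ?_ ?_ ?_
    · obtain ⟨e, h1, h2⟩ := exists_cls (inclAmalgamation q.1.rep)
      apply e.cancel
      rw [← FirstOrder.Language.Embedding.comp_assoc, ← FirstOrder.Language.Embedding.comp_assoc,
        h1, h2]
      exact q.2
    · rintro q - q' - h
      obtain ⟨e, h1, h2⟩ := Quotient.exact (congrArg Subtype.val h)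
      apply Subtype.ext
      rw [← Quotient.out_eq q.1, ← Quotient.out_eq q'.1]
      exact Quotient.sound ⟨e, h1, h2⟩
    · rintro q -
      exact by simp
    · rintro q - hq
      by_contra h0
      apply hq
      have hm : μ.mass q.1.pt ≠ 0 := by
        rw [← μ.mass_mul q.1.inl]
        exact mul_ne_zero h0 X'.2.2
      let Z : Amalgamation X' Y :=
        { pt := ⟨q.1.pt.1, q.1.pt.2, hm⟩
          inl := q.1.inl
          inr := q.1.inr
          surj := q.1.rep.surj }
      have hZ : inclAmalgamation Z = q.1.rep := rfl
      obtain ⟨e, h1, h2⟩ := exists_cls Z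
      refine ⟨⟨Z.cls, ?_⟩, by simp, ?_⟩
      · apply e.cancel
        rw [← FirstOrder.Language.Embedding.comp_assoc,
          ← FirstOrder.Language.Embedding.comp_assoc, h1, h2]
        exact q.2
      · apply Subtype.ext
        obtain ⟨e', h1', h2'⟩ := Quotient.exact (Quotient.out_eq Z.cls)
        refine Eq.trans ?_ (Quotient.out_eq q.1)
        exact Quotient.sound ⟨e', h1', h2'⟩
    · rintro q -
      obtain ⟨e, h1, h2⟩ := exists_cls (inclAmalgamation q.1.rep)
      have hs := (inclAmalgamation q.1.rep).surj.surjective h1 h2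
      have h3 := μ.map_comp (inclAmalgamation q.1.rep).cls.inl e
      rw [h1, μ.map_surj e hs, one_mul] at h3
      exact h3

end Measure

end Fraisse

end

/-! A morphism of the permutation category is an invariant matrix: over each structure `W` its
entries are indexed by pairs of points, a point being a member of the family together with an
embedding into `W`. The functor `Φ` keeps the entries over those `W` with `μ(W) ≠ 0` and forgets the
others.

Everything rests on `mass_mul`, the identity `μ(X → W) μ(X) = μ(W)`. It shows that whatever embeds
into a structure of non-zero measure has non-zero measure (`mass_ne_zero_of_emb`), so over `W ∈ 𝔉'`
a family and its subfamily of members of non-zero measure have the same points (`restrictPt`). It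
also shows, `k` being a domain, that `μ(W) ≠ 0` and `μ(V) = 0` force `μ(W → V) = 0`. An entry of a
composite over `W` is a sum over the amalgamations `V` of `W` with the members of the middle family,
weighted by `μ(W → V)`. For `W ∈ 𝔉'` the `V` outside `𝔉'` drop out, and what remains is the sum
computed with `μ'` (`integ_eq_zero`, `integ_restrict`, `integ_restrictObj`). Hence `Φ` respects
composition.

The tensor product is the Kronecker product, and the structural isomorphisms are permutation
matrices of bijections of points. Since points over `W ∈ 𝔉'` are unaffected by `Φ`, the monoidal
comparison maps are permutation matrices as well, and the coherence axioms become identities between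
bijections (`restrictTensor`, `restrictMap_mor`). A family in `𝔉'` is also a family in `𝔉`, whence
essential surjectivity. A matrix for `𝔉'` lifts by giving the amalgamations outside `𝔉'` the
coefficient zero, whence fullness (`restrictMap_ofFun_extendFun`). The values on `φ_Z` are read off
from `ev_phi`: its matrix is the indicator function of the pairs with joint image `Z`. -/

noncomputable section

namespace Fraisse

variable {L : FirstOrder.Language.{u, v}} {𝔉 : FraisseClass.{u, v, w} L} [L.IsRelational]
  [IsEmpty (L.Relations 0)] {k : Type r} [CommRing k] [IsDomain k]

/-! ### Integrals relative to a structure of non-zero measure. -/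

namespace Measure

omit [IsDomain k] in
-- By `mass_mul`, `μ(X)` is a factor of `μ(Y)`. This is why a point over a member of `𝔉'` always
-- belongs to a member of non-zero measure.
theorem mass_ne_zero_of_emb (μ : Measure 𝔉 k) {X Y : 𝔉.Obj} (i : Emb X Y) (h : μ.mass Y ≠ 0) :
    μ.mass X ≠ 0 := by
  rw [← μ.mass_mul i] at h
  exact right_ne_zero_of_mul h

/-- Integrals over a structure of measure zero vanish, relative to a structure of non-zero
measure. -/
theorem integ_eq_zero (μ : Measure 𝔉 k) {W Y : 𝔉.Obj} (hW : μ.mass W ≠ 0) (hY : μ.mass Y = 0)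
    (φ : ∀ V : 𝔉.Obj, Emb W V → Emb Y V → k) : μ.integ W Y φ = 0 := by
  refine Finset.sum_eq_zero fun q _ => ?_
  -- The measure of the amalgamation is computed in two ways. Through `q.inr` it has the factor
  -- `μ(Y) = 0`, so `μ(q.inl) μ(W) = 0`, and since `μ(W) ≠ 0` the weight `μ(q.inl)` of this term
  -- vanishes.
  have h := μ.mass_mul q.inl
  rw [← μ.mass_mul q.inr, hY, mul_zero] at h
  rw [(mul_eq_zero.1 h).resolve_right hW, zero_mul]

variable {μ : Measure 𝔉 k}

/-- A member of `𝔉` of non-zero measure, regarded as a member of `𝔉'`. -/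
abbrev toNonzero (X : 𝔉.Obj) (h : μ.mass X ≠ 0) : μ.nonzero.Obj := ⟨X.1, X.2, h⟩

/-- An isomorphism of amalgamations is an isomorphism of structures compatible with the embeddings;
it does not depend on the class in which the structures are considered. -/
theorem inclAmalgamation_cls_injective {X Y : μ.nonzero.Obj} {Z Z' : Amalgamation X Y}
    (h : (inclAmalgamation Z).cls = (inclAmalgamation Z').cls) : Z.cls = Z'.cls := by
  obtain ⟨e, h1, h2⟩ := Quotient.exact h
  exact Quotient.sound ⟨e, h1, h2⟩

/-- The substructure on the union of the two images lies in `𝔉'` by heredity, so forming the joint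
image commutes with passing from `𝔉'` to `𝔉`. -/
theorem cls_incl {X Y W : μ.nonzero.Obj} (x : Emb X W) (y : Emb Y W) :
    cls (X := incl X) (Y := incl Y) (W := incl W) x y = (inclAmalgamation (image x y)).cls :=
  cls_mk (W := incl W) (inclAmalgamation (image x y)) (imageIncl x y)

/-- Used to compare the matrices of `φ_Z` in the two categories, in `restrictMap_phi`. -/
theorem cls_incl_eq_iff {X Y W : μ.nonzero.Obj} (x : Emb X W) (y : Emb Y W)
    (Z : Amalgamation X Y) :
    cls (X := incl X) (Y := incl Y) (W := incl W) x y = (inclAmalgamation Z).cls ↔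
      cls x y = Z.cls := by
  rw [cls_incl]
  refine ⟨inclAmalgamation_cls_injective, fun h => ?_⟩
  obtain ⟨e, h1, h2⟩ := Quotient.exact h
  exact Quotient.sound ⟨e, h1, h2⟩

/-- Integrals relative to a structure of non-zero measure only involve amalgamations of non-zero
measure. -/
theorem integ_restrict {W Y : μ.nonzero.Obj}
    {φ : ∀ V : 𝔉.Obj, Emb (incl W) V → Emb (incl Y) V → k} (hφ : Natural₂ φ) :
    μ.integ (incl W) (incl Y) φ = μ.restrict.integ W Y (fun V f y => φ (incl V) f y) := by
  symm
  -- The classes in `𝔉'` and in `𝔉` are different quotients; a class in `𝔉'` is sent to the class in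
  -- `𝔉` of its representative. It remains to see that this is injective, that terms outside the
  -- image vanish, and that corresponding terms agree.
  refine Finset.sum_of_injOn (fun q : Amalg W Y => (inclAmalgamation q.rep).cls) ?_ ?_ ?_ ?_
  · rintro q - q' - h
    rw [← Quotient.out_eq q, ← Quotient.out_eq q']
    exact inclAmalgamation_cls_injective h
  · rintro q -
    simp
  · rintro q - hq
    -- A non-zero term has `μ(W → V) ≠ 0`; multiplied by `μ(W) ≠ 0` this gives `μ(V) ≠ 0`, as `k` is
    -- a domain. So `V` is in `𝔉'` and the class lies in the image.
    by_contra h0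
    apply hq
    have hm : μ.mass q.pt ≠ 0 := by
      rw [← μ.mass_mul q.inl]
      exact mul_ne_zero (left_ne_zero_of_mul h0) W.2.2
    let Z : Amalgamation W Y :=
      { pt := toNonzero q.pt hm
        inl := q.inl
        inr := q.inr
        surj := q.rep.surj }
    refine ⟨Z.cls, by simp, ?_⟩
    -- The representative chosen for `Z.cls` is only isomorphic to `Z`; that isomorphism identifies
    -- the two classes in `𝔉`.
    obtain ⟨e, h1, h2⟩ := Quotient.exact (Quotient.out_eq Z.cls)
    refine Eq.trans ?_ (Quotient.out_eq q)
    exact Quotient.sound ⟨e, h1, h2⟩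
  · rintro q -
    -- The representatives chosen in `𝔉'` and in `𝔉` differ by the isomorphism `e`. The weight does
    -- not change because `μ(e) = 1`, and the integrand does not change because `φ` is natural.
    obtain ⟨e, h1, h2⟩ := exists_cls (inclAmalgamation q.rep)
    have hs := (inclAmalgamation q.rep).surj.surjective h1 h2
    have h3 := μ.map_comp (inclAmalgamation q.rep).cls.inl e
    rw [h1, μ.map_surj e hs, one_mul] at h3
    have h4 := hφ _ _ e (inclAmalgamation q.rep).cls.inl (inclAmalgamation q.rep).cls.inr
    rw [h1, h2] at h4
    exact congrArg₂ (· * ·) h3 h4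

end Measure

open Fraisse.Measure

/-! ### The functor `Φ`: restriction of matrices to points over members of `𝔉'`. -/

namespace Perm

variable {μ : Measure 𝔉 k}

/-- The subfamily of the members of non-zero measure. -/
def restrictObj (M : Perm μ) : Perm μ.restrict where
  ι := {i : M.ι // μ.mass (M.X i).obj ≠ 0}
  fintype := Fintype.ofFinite _
  X i := ⟨toNonzero (M.X i.1).obj i.2⟩

/-- Over a structure of non-zero measure, the points of a family and of its subfamily of members of
non-zero measure are the same. -/
def restrictPt (M : Perm μ) (W : μ.nonzero.Obj) : Pt (restrictObj M) W ≃ Pt M (incl W) where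
  toFun p := ⟨p.1.1, p.2⟩
  -- The point itself embeds its member of the family into `W`, which has non-zero measure.
  invFun p := ⟨⟨p.1, μ.mass_ne_zero_of_emb p.2 W.2.2⟩, p.2⟩
  left_inv _ := rfl
  right_inv _ := rfl

theorem restrictPt_push {M : Perm μ} {W V : μ.nonzero.Obj} (f : Emb W V)
    (p : Pt (restrictObj M) W) :
    restrictPt M V (p.push f) = (restrictPt M W p).push (V := incl V) f := rfl

theorem restrictPt_symm_push {M : Perm μ} {W V : μ.nonzero.Obj} (f : Emb W V)
    (p : Pt M (incl W)) :
    (restrictPt M V).symm (p.push (V := incl V) f) = ((restrictPt M W).symm p).push f := rfl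

/-- The submatrix of a morphism with rows and columns of non-zero measure. -/
def restrictMap {M N : Perm μ} (A : M ⟶ N) : restrictObj M ⟶ restrictObj N :=
  ofFun fun W p q => ev A (incl W) (restrictPt M W p) (restrictPt N W q)

/-- The restricted entries are still natural, so `ofFun` reproduces them at every `W` and not only
at chosen representatives. Together with `ev_ext`, this reduces identities between restricted
morphisms to identities between entries. -/
theorem ev_restrictMap {M N : Perm μ} (A : M ⟶ N) (W : μ.nonzero.Obj)
    (p : Pt (restrictObj M) W) (q : Pt (restrictObj N) W) :
    ev (restrictMap A) W p q = ev A (incl W) (restrictPt M W p) (restrictPt N W q) :=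
  ev_ofFun (fun V V' e p q =>
    ev_natural A (incl V) (incl V') e (restrictPt M V p) (restrictPt N V q)) W p q

/-- The heart of functoriality. Two kinds of terms are lost, and both are zero: the members of `N`
of measure zero, by `integ_eq_zero`, and, for the other members, the amalgamations of measure zero,
by `integ_restrict`. -/
theorem integ_restrictObj {W : μ.nonzero.Obj} {N : Perm μ}
    {φ : ∀ V : 𝔉.Obj, Emb (incl W) V → Pt N V → k} (hφ : RelNatural φ) :
    integ (incl W) N φ =
      integ W (restrictObj N) (fun V f q => φ (incl V) f (restrictPt N V q)) := by
  classical
  symm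
  refine Finset.sum_of_injOn (fun j : (restrictObj N).ι => j.1) ?_ ?_ ?_ ?_
  · rintro i - j - h
    exact Subtype.ext h
  · rintro i -
    simp
  · rintro j - hj
    refine μ.integ_eq_zero W.2.2 ?_ _
    by_contra h
    exact hj ⟨⟨j, h⟩, Finset.mem_coe.2 (Finset.mem_univ _), rfl⟩
  · rintro j -
    exact (integ_restrict (W := W) (Y := ((restrictObj N).X j).obj)
      (φ := fun V f y => φ V f ⟨j.1, y⟩) fun V V' e a b => hφ V V' e a ⟨j.1, b⟩).symm

/-- The functor `Φ` discarding the structures of measure zero. -/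
def restrictFunctor (μ : Measure 𝔉 k) : Perm μ ⥤ Perm μ.restrict where
  obj := restrictObj
  map := restrictMap
  map_id M := ev_ext fun W p q => by
    rw [ev_restrictMap, ev_id, ev_id]
    -- The identity matrix restricts to the identity matrix because `restrictPt` is injective.
    exact kron_congr (restrictPt M W).apply_eq_iff_eq
  map_comp A B := ev_ext fun W p r => by
    -- An entry of a composite is an integral relative to `W ∈ 𝔉'`, and such an integral does not
    -- see what `Φ` discards.
    rw [ev_restrictMap, ev_comp, ev_comp, integ_restrictObj (comp_relNatural A B _ _)]
    refine integ_congr fun V f q => ?_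
    rw [ev_restrictMap, ev_restrictMap]
    rfl

theorem restrictMap_add {M N : Perm μ} (A B : M ⟶ N) :
    restrictMap (A + B) = restrictMap A + restrictMap B :=
  ev_ext fun W p q => by simp only [ev_restrictMap, ev_add]

theorem restrictMap_smul {M N : Perm μ} (c : k) (A : M ⟶ N) :
    restrictMap (c • A) = c • restrictMap A :=
  ev_ext fun W p q => by simp only [ev_restrictMap, ev_smul]

instance : (restrictFunctor μ).Additive where
  map_add := restrictMap_add _ _

instance : (restrictFunctor μ).Linear k where
  map_smul A c := restrictMap_smul c A

/-! ### `Φ` as a symmetric monoidal functor. -/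

/-- The restriction of a natural bijection of points. -/
def PtIso.restrict {M N : Perm μ} (e : PtIso M N) : PtIso (restrictObj M) (restrictObj N) where
  equiv W := (restrictPt M W).trans ((e.equiv (incl W)).trans (restrictPt N W).symm)
  nat {W V} f p := congrArg (restrictPt N V).symm
    (e.nat (W := incl W) (V := incl V) f (restrictPt M W p))

/-- This turns the coherence axioms for `Φ` into equalities of bijections: after it, every arrow in
those diagrams is a permutation matrix. -/
theorem restrictMap_mor {M N : Perm μ} (e : PtIso M N) : restrictMap e.mor = e.restrict.mor :=
  ev_ext fun W p q => by
    rw [ev_restrictMap, e.ev_mor, PtIso.ev_mor]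
    exact kron_congr (Equiv.symm_apply_eq _).symm

/-- Compatibility of `Φ` with tensor products, on points. -/
def restrictTensor (M N : Perm μ) :
    PtIso (tensor (restrictObj M) (restrictObj N)) (restrictObj (tensor M N)) where
  -- The index sets of the two families differ: iterated choices of classes in `𝔉'` on one side,
  -- classes in `𝔉` of non-zero measure on the other. Only the points are compared; on both sides
  -- they are the pairs of a point of `M` and a point of `N`.
  equiv W :=
    { toFun := fun t => (restrictPt _ W).symm
        (pair (restrictPt M W (fst t)) (restrictPt N W (snd t)))
      invFun := fun t => pair ((restrictPt M W).symm (fst (restrictPt _ W t)))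
        ((restrictPt N W).symm (snd (restrictPt _ W t)))
      left_inv := fun t => by simp
      right_inv := fun t => by simp }
  nat {W V} f t := by
    simp only [Equiv.coe_fn_mk, fst_push, snd_push, restrictPt_push, ← restrictPt_symm_push]
    rw [pair_push (V := incl V)]

/-- Compatibility of `Φ` with units, on points. -/
def restrictUnit (μ : Measure 𝔉 k) : PtIso (unit μ.restrict) (restrictObj (unit μ)) where
  -- Both sides have exactly one point over `W`, since the empty structure embeds in exactly one
  -- way.
  equiv W :=
    { toFun := fun _ => (restrictPt _ W).symm (star (incl W))
      invFun := fun _ => star W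
      left_inv := fun p => (eq_star p).symm
      right_inv := fun p => by
        rw [Equiv.symm_apply_eq]
        exact (eq_star _).symm }
  nat {W V} f _ := (congrArg (restrictPt (unit μ) V).symm
    (eq_star (Pt.push (W := incl W) (V := incl V) f (star (incl W))))).symm

/-- `Φ` is strong monoidal. -/
def restrictCoreMonoidal (μ : Measure 𝔉 k) : (restrictFunctor μ).CoreMonoidal where
  εIso := (restrictUnit μ).iso
  μIso M N := (restrictTensor M N).iso
  μIso_hom_natural_left {M N} A K := by
    change tensorMor (restrictMap A) (𝟙 (restrictObj K)) ≫ (restrictTensor N K).mor =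
      (restrictTensor M K).mor ≫ restrictMap (tensorMor A (𝟙 K))
    refine ev_ext fun W t t' => ?_
    rw [PtIso.ev_comp_mor, PtIso.ev_mor_comp, ev_restrictMap, ev_tensorMor, ev_tensorMor,
      ev_restrictMap, ev_id, ev_id]
    simp only [restrictTensor, Equiv.coe_fn_mk, Equiv.coe_fn_symm_mk, fst_pair, snd_pair,
      Equiv.apply_symm_apply]
    -- The identity of `K` contributes a Kronecker delta on each side, one on points of `restrictObj
    -- K` and one on points of `K`; `restrictPt` matches them.
    rw [kron_congr (Equiv.eq_symm_apply _)]
  μIso_hom_natural_right {M N} K A := by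
    change tensorMor (𝟙 (restrictObj K)) (restrictMap A) ≫ (restrictTensor K N).mor =
      (restrictTensor K M).mor ≫ restrictMap (tensorMor (𝟙 K) A)
    refine ev_ext fun W t t' => ?_
    rw [PtIso.ev_comp_mor, PtIso.ev_mor_comp, ev_restrictMap, ev_tensorMor, ev_tensorMor,
      ev_restrictMap, ev_id, ev_id]
    simp only [restrictTensor, Equiv.coe_fn_mk, Equiv.coe_fn_symm_mk, fst_pair, snd_pair,
      Equiv.apply_symm_apply]
    rw [kron_congr (Equiv.eq_symm_apply _)]
  associativity M N K := by
    change tensorMor (restrictTensor M N).mor (𝟙 (restrictObj K)) ≫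
        (restrictTensor (tensor M N) K).mor ≫ restrictMap (assocIso M N K).mor =
      (assocIso (restrictObj M) (restrictObj N) (restrictObj K)).mor ≫
        tensorMor (𝟙 (restrictObj M)) (restrictTensor N K).mor ≫
          (restrictTensor M (tensor N K)).mor
    -- All arrows are permutation matrices, so both composites are too; on points both are `((x, y),
    -- z) ↦ (x, (y, z))`. The unit axioms are handled in the same way.
    rw [restrictMap_mor, ← PtIso.refl_mor, ← PtIso.refl_mor, PtIso.tensorMor_mor,
      PtIso.tensorMor_mor, PtIso.mor_comp_mor, PtIso.mor_comp_mor, PtIso.mor_comp_mor,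
      PtIso.mor_comp_mor]
    refine PtIso.mor_ext fun W t => ?_
    simp [PtIso.trans, PtIso.tensor, PtIso.refl, PtIso.restrict, assocIso, restrictTensor]
  left_unitality M := by
    change (leftIso (restrictObj M)).mor =
      tensorMor (restrictUnit μ).mor (𝟙 (restrictObj M)) ≫ (restrictTensor (unit μ) M).mor ≫
        restrictMap (leftIso M).mor
    rw [restrictMap_mor, ← PtIso.refl_mor, PtIso.tensorMor_mor, PtIso.mor_comp_mor,
      PtIso.mor_comp_mor]
    refine PtIso.mor_ext fun W t => ?_
    simp [PtIso.trans, PtIso.tensor, PtIso.refl, PtIso.restrict, leftIso, restrictTensor]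
  right_unitality M := by
    change (rightIso (restrictObj M)).mor =
      tensorMor (𝟙 (restrictObj M)) (restrictUnit μ).mor ≫ (restrictTensor M (unit μ)).mor ≫
        restrictMap (rightIso M).mor
    rw [restrictMap_mor, ← PtIso.refl_mor, PtIso.tensorMor_mor, PtIso.mor_comp_mor,
      PtIso.mor_comp_mor]
    refine PtIso.mor_ext fun W t => ?_
    simp [PtIso.trans, PtIso.tensor, PtIso.refl, PtIso.restrict, rightIso, restrictTensor]

instance : (restrictFunctor μ).Monoidal := (restrictCoreMonoidal μ).toMonoidal

/-- `Φ` is compatible with the symmetries. -/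
instance : (restrictFunctor μ).Braided where
  braided M N := by
    change (restrictTensor M N).mor ≫ restrictMap (braidIso M N).mor =
      (braidIso (restrictObj M) (restrictObj N)).mor ≫ (restrictTensor N M).mor
    rw [restrictMap_mor, PtIso.mor_comp_mor, PtIso.mor_comp_mor]
    refine PtIso.mor_ext fun W t => ?_
    simp [PtIso.trans, PtIso.restrict, braidIso, restrictTensor]

/-! ### Essential surjectivity and fullness. -/

/-- A family of members of `𝔉'`, regarded as a family of members of `𝔉`. -/
def inclObj (N : Perm μ.restrict) : Perm μ where
  ι := N.ι
  fintype := N.fintype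
  X j := ⟨incl (N.X j).obj⟩

/-- `Φ` sends a family of structures of non-zero measure to itself. -/
def restrictIncl (N : Perm μ.restrict) : PtIso (restrictObj (inclObj N)) N where
  equiv _ :=
    { toFun := fun p => ⟨p.1.1, p.2⟩
      invFun := fun p => ⟨⟨p.1, (N.X p.1).obj.2.2⟩, p.2⟩
      left_inv := fun _ => rfl
      right_inv := fun _ => rfl }
  nat _ _ := rfl

instance : (restrictFunctor μ).EssSurj where
  mem_essImage N := ⟨inclObj N, ⟨(restrictIncl N).iso⟩⟩

open Classical in
/-- Extension by zero of the values of a morphism of `Perm_k(𝔉'; μ')`. -/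
def extendFun {M N : Perm μ} (B : restrictObj M ⟶ restrictObj N) (W : 𝔉.Obj) (p : Pt M W)
    (q : Pt N W) : k :=
  if h : μ.mass W ≠ 0 then
    ev B (toNonzero W h) ((restrictPt M (toNonzero W h)).symm p)
      ((restrictPt N (toNonzero W h)).symm q)
  else 0

/-- Extension by zero is not natural in general: along an embedding of a structure of non-zero
measure into one of measure zero, a non-zero value may become `0`. What survives is compatibility
with embeddings into members of `𝔉'`, whose sources have non-zero measure as well. -/
theorem extendFun_eq {M N : Perm μ} (B : restrictObj M ⟶ restrictObj N) {V : 𝔉.Obj}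
    {W : μ.nonzero.Obj} (e : Emb V (incl W)) (p : Pt M V) (q : Pt N V) :
    extendFun B V p q =
      ev B W ((restrictPt M W).symm (p.push e)) ((restrictPt N W).symm (q.push e)) :=
  have h := μ.mass_ne_zero_of_emb e W.2.2
  (dif_pos h).trans (ev_natural B (toNonzero V h) W e ((restrictPt M (toNonzero V h)).symm p)
    ((restrictPt N (toNonzero V h)).symm q)).symm

theorem restrictMap_ofFun_extendFun {M N : Perm μ} (B : restrictObj M ⟶ restrictObj N) :
    restrictMap (ofFun (extendFun B)) = B := ev_ext fun W p q => by
  -- As `extendFun B` need not be natural, `ev_ofFun` is not available. By definition `ofFun` takes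
  -- the value at the chosen representative of the joint image; `e` embeds that representative into
  -- `W`, so `extendFun_eq` moves the value to `W`, where `h1` and `h2` recover `p` and `q`.
  obtain ⟨e, h1, h2⟩ := exists_lift (restrictPt M W p).emb (restrictPt N W q).emb
  rw [ev_restrictMap]
  refine (extendFun_eq B e ⟨_, Amalg.inl _⟩ ⟨_, Amalg.inr _⟩).trans ?_
  rw [Pt.push, Pt.push, h1, h2]
  rfl

instance : (restrictFunctor μ).Full where
  map_surjective B := ⟨ofFun (extendFun B), restrictMap_ofFun_extendFun B⟩

/-! ### The values of `Φ` on `Vec_X` and `φ_Z`. -/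

open Classical in
omit [IsDomain k] [IsEmpty (L.Relations 0)] in
-- Since `φ_Z` is a basis vector, its matrix is the indicator function of the pairs of points with
-- joint image `Z`.
theorem ev_phi {X Y : 𝔉.Obj} (Z : Amalgamation X Y) (W : 𝔉.Obj) (p : Pt (vec μ X) W)
    (q : Pt (vec μ Y) W) : ev (phi μ Z) W p q =
      if cls (X := X) (Y := Y) p.emb q.emb = Z.cls then 1 else 0 := by
  refine (Finsupp.single_apply (a := Z.cls)).trans ?_
  exact if_congr eq_comm rfl rfl

/-- `Φ(Vec_X)` is `Vec_X` if `X` has non-zero measure. -/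
def restrictVec (X : μ.nonzero.Obj) :
    PtIso (restrictObj (vec μ (incl X))) (vec μ.restrict X) :=
  -- The one-member family `Vec_X` of `𝔉'`, regarded as a family in `𝔉`, is `Vec_X` by definition.
  restrictIncl (vec μ.restrict X)

/-- Both sides are indicator functions, and by `cls_incl_eq_iff` a joint image inside `W ∈ 𝔉'` is
`Z` in one class exactly when it is in the other. -/
theorem restrictMap_phi {X Y : μ.nonzero.Obj} (Z : Amalgamation X Y) :
    restrictMap (phi μ (inclAmalgamation Z)) ≫ (restrictVec Y).mor =
      (restrictVec X).mor ≫ phi μ.restrict Z := by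
  classical
  refine ev_ext fun W p q => ?_
  rw [PtIso.ev_comp_mor, PtIso.ev_mor_comp, ev_restrictMap, ev_phi, ev_phi]
  exact if_congr (cls_incl_eq_iff (X := X) (Y := Y) p.emb q.emb Z) rfl rfl

/-- A non-zero entry over `W ∈ 𝔉'` would exhibit `Z` as a joint image inside `W`, and then `μ(Z) ≠
0`. -/
theorem restrictMap_phi_eq_zero {X Y : 𝔉.Obj} (Z : Amalgamation X Y) (hZ : μ.mass Z.pt = 0) :
    restrictMap (phi μ Z) = 0 := by
  classical
  refine ev_ext fun W p q => ?_
  rw [ev_restrictMap, ev_phi, ev_zero, if_neg]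
  intro h
  -- Taking the identity of `Z` in `cls_mk` shows that `Z` is the joint image of its own two
  -- embeddings, which is the form `exists_emb` needs.
  obtain ⟨e, -, -⟩ := exists_emb Z.surj
    ((cls_mk Z (Language.Embedding.refl L Z.pt.1)).trans h.symm)
  exact μ.mass_ne_zero_of_emb e W.2.2 hZ

/-- The only member of the family is discarded, so the restricted family is empty and its identity
is a matrix without entries. -/
theorem isZero_restrictObj_vec {X : 𝔉.Obj} (hX : μ.mass X = 0) :
    Limits.IsZero (restrictObj (vec μ X)) := by
  rw [Limits.IsZero.iff_id_eq_zero]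
  exact ev_ext fun W p q => absurd hX p.idx.2

end Perm

end Fraisse

end

open CategoryTheory Fraisse in
/-- `Φ` is a tensor functor (additive, `k`-linear, strong monoidal, compatible with the symmetries)
with `Φ(Vec_X) ≅ Vec_X` and, under these isomorphisms, `Φ(φ_Z) = φ_Z` for `X`, `Z` of non-zero
measure, with `Φ(Vec_X) = 0` and `Φ(φ_Z) = 0` for `X`, `Z` of measure zero, and `Φ` is essentially
surjective and full. -/
theorem proposition4p2 {L : FirstOrder.Language.{u, v}} [L.IsRelational]
    [IsEmpty (L.Relations 0)] (𝔉 : FraisseClass.{u, v, w} L) {k : Type r} [CommRing k] [IsDomain k]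
    (μ : Fraisse.Measure 𝔉 k) :
    ∃ Φ : Perm μ ⥤ Perm μ.restrict,
      (Φ.Additive ∧ Φ.Linear k ∧ Nonempty Φ.Braided) ∧
      (∃ e : ∀ X : μ.nonzero.Obj,
          Φ.obj (Perm.vec μ (Measure.incl X)) ≅ Perm.vec μ.restrict X,
        ∀ (X Y : μ.nonzero.Obj) (Z : Amalgamation X Y),
          Φ.map (Perm.phi μ (Measure.inclAmalgamation Z)) ≫ (e Y).hom =
            (e X).hom ≫ Perm.phi μ.restrict Z) ∧
      (∀ X : 𝔉.Obj, μ.mass X = 0 → Limits.IsZero (Φ.obj (Perm.vec μ X))) ∧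
      (∀ (X Y : 𝔉.Obj) (Z : Amalgamation X Y), μ.mass Z.pt = 0 → Φ.map (Perm.phi μ Z) = 0) ∧
      Φ.EssSurj ∧ Φ.Full :=
  ⟨Perm.restrictFunctor μ, ⟨inferInstance, inferInstance, ⟨inferInstance⟩⟩,
    ⟨fun X => (Perm.restrictVec X).iso, fun _ _ Z => Perm.restrictMap_phi Z⟩,
    fun _ => Perm.isZero_restrictObj_vec, fun _ _ => Perm.restrictMap_phi_eq_zero,
    inferInstance, inferInstance⟩
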